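/- **Setting.** Let $h:\mathbb R\to\mathbb R$ satisfy $h(0)=0$, be strictly concave and strictly increasing on $[0,\infty)$, and strictly concave and strictly decreasing on $(-\infty,0]$, and let $c(x,z)=h(z-x)$ be the cost of mismatch of worker skill $x$ and job difficulty $z$ (for example $c(x,z)=\rho_1(z-x)^{\zeta_1}$ for $z\ge x$ and $c(x,z)=\rho_2(x-z)^{\zeta_2}$ for $z<x$, with $\rho_i>0$, $0<\zeta_i<1$). Let $F$ (workers) and $G$ (jobs) be finite measures on $\mathbb R$ with disjoint finite supports $X$ and $Z$, let $\pi$ be an optimal assignment, that is, a measure with marginals $F,G$ minimizing $\int c\,d\pi$, and let $\Gamma=\{(x,z):\pi(\{(x,z)\})>0\}$. For a pair $(x,z)$, $[x,z]$ is the set of reals between $x$ and $z$ (in either order), and the skill group of the pair is $S_{[x,z]}=(X\cup Z)\cap[x,z]$. A subpair of $(x_0,z_0)\in\Gamma$ is a pair of $\Gamma$ other than $(x_0,z_0)$ whose interval lies in $[x_0,z_0]$ and is not contained in the interval of another such pair. An outermost pair is a pair of $\Gamma$ whose interval is not contained in that of another pair of $\Gamma$. **The local hierarchical mechanism.** Process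 the pairs of $\Gamma$ one at a time, in any order in which each pair comes after all of its subpairs. Let $(x_0,z_0)$ be the pair to be processed, $(x_1,z_1),\dots,(x_p,z_p)$ its subpairs in dictionary order, $\phi_i$ the function already computed at $(x_i,z_i)$, and $c_{ij}=c(x_i,z_j)$. Compute $\phi=\phi_{[x_0,z_0]}$ on $S_{[x_0,z_0]}$ as follows. If $p=0$, put $\phi(z_0)=0$, $\phi(x_0)=c(x_0,z_0)$. If $p\ge1$, choose any solution $(\beta_2,\dots,\beta_p)$ of the linear system $$\max(c_{00}-c_{0n}-c_{m0},\,-c_{mn})+c_{nn}\le\sum_{k=n+1}^m\beta_k\le\min(c_{0m}+c_{n0}-c_{00},\,c_{nm})-c_{mm}\qquad(1\le n<m\le p),\tag{1}$$ put $\phi(s)=\phi_i(s)+\sum_{k=i+1}^p\beta_k+\phi_p(x_p)-\phi_i(x_i)$ for $s\in S_{[x_i,z_i]}$, $1\le i\le p$, then $\phi(z_0)=\max_{1\le i\le p}(\phi(x_i)-c(x_i,z_0))$ if $x_1\ne x_0$, $\phi(z_0)=\min_{1\le i\le p}(\phi(z_i)+c(x_0,z_i))-c(x_0,z_0)$ if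 $x_1=x_0$, and $\phi(x_0)=\phi(z_0)+c(x_0,z_0)$. When all pairs are processed, let $(x_1,z_1),\dots,(x_r,z_r)$ be the outermost pairs in dictionary order, with functions $\phi_1,\dots,\phi_r$; choose any solution $(\gamma_2,\dots,\gamma_r)$ of $$-c_{mn}+c_{nn}\le\sum_{k=n+1}^m\gamma_k\le c_{nm}-c_{mm}\qquad(1\le n<m\le r)\tag{2}$$ and output $\phi(s)=\phi_i(s)+\sum_{k=i+1}^r\gamma_k+\phi_r(x_r)-\phi_i(x_i)$ for $s\in S_{[x_i,z_i]}$, $1\le i\le r$ (so $\phi=\phi_1$ if $r=1$). The default choice in (1) is the solution that is smallest in dictionary order. **Theorem.** (a) For every pair of $\Gamma$, system (1) has a solution, and it has a smallest one in dictionary order; system (2) has a solution. (b) The mechanism never gets stuck: as long as there are unprocessed pairs, one of them can be processed; for every pair that can be processed and every solution of (1), the formulas above are consistent and determine $\phi_{[x_0,z_0]}$ on $S_{[x_0,z_0]}$; when all pairs are processed, for every solution of (2) the formulas are consistent and determine the output $\phi$ on $X\cup Z$. In particular the mechanism with the default choices has an output. (c) For all choices made, every computed $\phi_{[x_0,z_0]}$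 is a local dual optimizer: $\phi_{[x_0,z_0]}(x)-\phi_{[x_0,z_0]}(z)\le c(x,z)$ for all $x\in X\cap[x_0,z_0]$, $z\in Z\cap[x_0,z_0]$, with equality if $(x,z)\in\Gamma$. (d) For all choices made, the output $\phi$ gives an optimal dual pair $(\phi,\psi)$ with $\psi=-\phi$: it maximizes $\int\phi\,dF+\int\psi\,dG$ among the pairs with $\phi(x)+\psi(z)\le c(x,z)$ for all $x\in X$, $z\in Z$; and $\phi(x)-\phi(z)=c(x,z)$ for $(x,z)\in\Gamma$. (e) Relative wages are determined locally. For $(x,z)\in\Gamma$ and $s,s'\in S_{[x,z]}$ one has $\phi(s)-\phi(s')=\phi_{[x,z]}(s)-\phi_{[x,z]}(s')$, and this depends only on the pairings within the group: if another such problem with the same cost $c$ (measures $F',G'$, optimal assignment $\pi'$) has the same set of pairs with interval inside $[x,z]$, and if the mechanism uses the same shifts $\beta$ at these pairs in both problems, or the default shifts at these pairs in both, then the group $S_{[x,z]}$ and the differences $\phi(s)-\phi(s')$, $s,s'\in S_{[x,z]}$, are the same in both problems. -/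

import Mathlib

open MeasureTheory

noncomputable section

/-- A worker-job pair `(x, z)`: worker skill first, job difficulty second. -/
abbrev Pair : Type := ℝ × ℝ

/-! ### Mismatch costs, optimal assignments and dual pairs -/

/-- `c x z = h (z - x)` is a concave cost of mismatch: zero when `x = z`, strictly concave and
strictly increasing in the underqualification `z - x ≥ 0` and in the overqualification
`x - z ≥ 0`, possibly with two different profiles.  The profile equal to `ρ₁ * t ^ ζ₁` at `t ≥ 0`
and to `ρ₂ * (-t) ^ ζ₂` at `t < 0`, with `ρ₁, ρ₂ > 0` and `ζ₁, ζ₂ ∈ (0, 1)`, is the leading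
example. -/
structure IsMismatchProfile (h : ℝ → ℝ) : Prop where
  zero : h 0 = 0
  concave_right : StrictConcaveOn ℝ (Set.Ici 0) h
  mono_right : StrictMonoOn h (Set.Ici 0)
  concave_left : StrictConcaveOn ℝ (Set.Iic 0) h
  anti_left : StrictAntiOn h (Set.Iic 0)

/-- The finite measure `μ` is carried by the finite set `A`, and `A` is exactly its set of atoms. -/
structure HasFiniteSupport {α : Type*} [MeasurableSpace α] (μ : Measure α) (A : Finset α) :
    Prop where
  mem_iff : ∀ a, a ∈ A ↔ 0 < μ {a}
  compl : μ ((A : Set α)ᶜ) = 0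

/-- `π` is an assignment between the worker measure `F` and the job measure `G`. -/
def IsAssignment (F G : Measure ℝ) (π : Measure Pair) : Prop :=
  π.map Prod.fst = F ∧ π.map Prod.snd = G

/-- `π` is an assignment of minimal total cost. -/
def IsOptimalAssignment (c : ℝ → ℝ → ℝ) (F G : Measure ℝ) (π : Measure Pair) : Prop :=
  IsAssignment F G π ∧
    ∀ π' : Measure Pair, IsAssignment F G π' →
      ∫ P, c P.1 P.2 ∂π ≤ ∫ P, c P.1 P.2 ∂π'

/-- The data of the problem: `F`, `G` are finite measures with disjoint finite supports `X`, `Z`,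
`π` is an optimal assignment between them, and `Γ` is the set of pairs formed by `π`. -/
structure IsOptimallyAssigned (c : ℝ → ℝ → ℝ) (F G : Measure ℝ) (X Z : Finset ℝ)
    (π : Measure Pair) (Γ : Finset Pair) : Prop where
  finite_F : IsFiniteMeasure F
  finite_G : IsFiniteMeasure G
  supp_F : HasFiniteSupport F X
  supp_G : HasFiniteSupport G Z
  disj : Disjoint X Z
  optimal : IsOptimalAssignment c F G π
  pairs : ∀ P, P ∈ Γ ↔ 0 < π {P}

/-- `φ(x) + ψ(z) ≤ c(x, z)` for all workers `x` and all jobs `z`. -/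
def IsDualFeasible (c : ℝ → ℝ → ℝ) (X Z : Finset ℝ) (φ ψ : ℝ → ℝ) : Prop :=
  ∀ x ∈ X, ∀ z ∈ Z, φ x + ψ z ≤ c x z

/-- `(φ, ψ)` solves the dual problem: it maximizes `∫ φ dF + ∫ ψ dG` among feasible pairs. -/
def IsOptimalDualPair (c : ℝ → ℝ → ℝ) (F G : Measure ℝ) (X Z : Finset ℝ) (φ ψ : ℝ → ℝ) : Prop :=
  IsDualFeasible c X Z φ ψ ∧
    ∀ φ' ψ' : ℝ → ℝ, IsDualFeasible c X Z φ' ψ' →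
      ∫ x, φ' x ∂F + ∫ z, ψ' z ∂G ≤ ∫ x, φ x ∂F + ∫ z, ψ z ∂G

/-- `φ` is a local dual optimizer on the set `A`: `φ(x) - φ(z) ≤ c(x, z)` for all workers `x` and
jobs `z` in `A`, with equality for the pairs of `Γ`. -/
def IsLocalDual (c : ℝ → ℝ → ℝ) (X Z : Finset ℝ) (Γ : Finset Pair) (A : Set ℝ) (φ : ℝ → ℝ) :
    Prop :=
  ∀ x ∈ X, ∀ z ∈ Z, x ∈ A → z ∈ A →
    φ x - φ z ≤ c x z ∧ ((x, z) ∈ Γ → φ x - φ z = c x z)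

/-! ### Skill groups and subpairs -/

/-- The interval `[x, z]` of a pair, regardless of whether `x < z` or `z < x`. -/
def interval (P : Pair) : Set ℝ := Set.uIcc P.1 P.2

/-- The skill group of a pair: the skill levels (of workers and of jobs) in its interval. -/
def skillGroup (X Z : Finset ℝ) (P : Pair) : Set ℝ := {s | (s ∈ X ∨ s ∈ Z) ∧ s ∈ interval P}

open Classical in
/-- The pairings inside the interval of `P`, including `P` itself if it is a pairing. -/
def pairsWithin (Γ : Finset Pair) (P : Pair) : Finset Pair :=
  Γ.filter fun Q => interval Q ⊆ interval P

open Classical in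
/-- The pairs of `A` that are not nested in another pair of `A`. -/
def maximalPairs (A : Finset Pair) : Finset Pair :=
  A.filter fun Q => ∀ R ∈ A, interval Q ⊆ interval R → R = Q

/-- The subpairs of `P`: the non-nested ones among the other pairs inside the interval of `P`. -/
def subpairs (Γ : Finset Pair) (P : Pair) : Finset Pair :=
  maximalPairs ((pairsWithin Γ P).erase P)

/-- The number `p` of subpairs of `P`. -/
def numSub (Γ : Finset Pair) (P : Pair) : ℕ := (subpairs Γ P).card

/-- `pairAt A i` is the `i`-th pair of `A` in dictionary order, for `1 ≤ i ≤ A.card`. -/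
def pairAt (A : Finset Pair) (i : ℕ) : Pair :=
  ofLex (((A.map toLex.toEmbedding).sort (· ≤ ·)).getD (i - 1) (toLex (0, 0)))

/-- `node Γ P 0 = P = (x₀, z₀)`, and `node Γ P i = (xᵢ, zᵢ)` is the `i`-th subpair of `P` in
dictionary order, for `1 ≤ i ≤ numSub Γ P`. -/
def node (Γ : Finset Pair) (P : Pair) (i : ℕ) : Pair :=
  if i = 0 then P else pairAt (subpairs Γ P) i

/-! ### The local hierarchical mechanism -/

/-- The linear inequality system for the shifts `β 2, …, β p` at the pair `P = (x₀, z₀)` with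
subpairs `(x₁, z₁), …, (x_p, z_p)`, where `C i j = c(xᵢ, zⱼ)`. -/
def IsShift (c : ℝ → ℝ → ℝ) (Γ : Finset Pair) (P : Pair) (β : ℕ → ℝ) : Prop :=
  let C : ℕ → ℕ → ℝ := fun i j => c (node Γ P i).1 (node Γ P j).2
  ∀ n m : ℕ, 1 ≤ n → n < m → m ≤ numSub Γ P →
    max (C 0 0 - C 0 n - C m 0) (-C m n) + C n n ≤ ∑ k ∈ Finset.Icc (n + 1) m, β k ∧
      ∑ k ∈ Finset.Icc (n + 1) m, β k ≤ min (C 0 m + C n 0 - C 0 0) (C n m) - C m m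

/-- `(β 2, …, β p)` is strictly smaller than `(β' 2, …, β' p)` in dictionary order, or equal
to it. -/
def ShiftLexLE (p : ℕ) (β β' : ℕ → ℝ) : Prop :=
  (∀ k ∈ Finset.Icc 2 p, β k = β' k) ∨
    ∃ k ∈ Finset.Icc 2 p, (∀ j ∈ Finset.Icc 2 p, j < k → β j = β' j) ∧ β k < β' k

/-- The default choice of shifts: the smallest solution in dictionary order. -/
def IsDefaultShift (c : ℝ → ℝ → ℝ) (Γ : Finset Pair) (P : Pair) (β : ℕ → ℝ) : Prop :=
  IsShift c Γ P β ∧ ∀ β', IsShift c Γ P β' → ShiftLexLE (numSub Γ P) β β'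

/-- `φ` is the potential computed at the pair `P` from the shifts `β` and the potentials `Φ` of
the subpairs of `P`. -/
structure IsPairPotential (c : ℝ → ℝ → ℝ) (X Z : Finset ℝ) (Γ : Finset Pair) (P : Pair)
    (β : ℕ → ℝ) (Φ : Pair → ℝ → ℝ) (φ : ℝ → ℝ) : Prop where
  /-- No subpairs. -/
  leaf : numSub Γ P = 0 → φ P.2 = 0 ∧ φ P.1 = c P.1 P.2
  /-- The potentials of the subpairs are shifted by constants. -/
  shift : ∀ i ∈ Finset.Icc 1 (numSub Γ P), ∀ s ∈ skillGroup X Z (node Γ P i),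
    φ s = Φ (node Γ P i) s + ∑ k ∈ Finset.Icc (i + 1) (numSub Γ P), β k
      + Φ (node Γ P (numSub Γ P)) (node Γ P (numSub Γ P)).1 - Φ (node Γ P i) (node Γ P i).1
  /-- The job of `P`, if the first subpair has another worker than `P`. -/
  job_max : ∀ hp : 1 ≤ numSub Γ P, (node Γ P 1).1 ≠ P.1 →
    φ P.2 = (Finset.Icc 1 (numSub Γ P)).sup' (Finset.nonempty_Icc.2 hp)
      fun i => φ (node Γ P i).1 - c (node Γ P i).1 P.2
  /-- The job of `P`, if the first subpair has the same worker as `P`. -/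
  job_min : ∀ hp : 1 ≤ numSub Γ P, (node Γ P 1).1 = P.1 →
    φ P.2 = (Finset.Icc 1 (numSub Γ P)).inf' (Finset.nonempty_Icc.2 hp)
      (fun i => φ (node Γ P i).2 + c P.1 (node Γ P i).2) - c P.1 P.2
  /-- The worker of `P`. -/
  worker : 1 ≤ numSub Γ P → φ P.1 = φ P.2 + c P.1 P.2

/-- `P` can be processed next: it is not yet processed, and all its subpairs are. -/
def IsReady (Γ D : Finset Pair) (P : Pair) : Prop := P ∈ Γ ∧ P ∉ D ∧ subpairs Γ P ⊆ D

/-- `Execution c X Z Γ D β Φ`: processing pairs one at a time, each after its subpairs and each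
with an arbitrary solution of its inequality system, can lead to the state in which the processed
pairs are those in `D`, with `β P` the shifts chosen at `P ∈ D` and `Φ P` the potential computed
at `P ∈ D`. -/
inductive Execution (c : ℝ → ℝ → ℝ) (X Z : Finset ℝ) (Γ : Finset Pair) :
    Finset Pair → (Pair → ℕ → ℝ) → (Pair → ℝ → ℝ) → Prop
  | start : Execution c X Z Γ ∅ (fun _ _ => 0) (fun _ _ => 0)
  | step (D : Finset Pair) (β : Pair → ℕ → ℝ) (Φ : Pair → ℝ → ℝ) (P : Pair) (b : ℕ → ℝ)
      (φ : ℝ → ℝ) (hex : Execution c X Z Γ D β Φ) (hready : IsReady Γ D P)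
      (hshift : IsShift c Γ P b) (hφ : IsPairPotential c X Z Γ P b Φ φ) :
      Execution c X Z Γ (insert P D) (Function.update β P b) (Function.update Φ P φ)

/-- The outermost pairs `(x₁, z₁), …, (x_r, z_r)`, in dictionary order, are `outer Γ 1`, …,
`outer Γ r` with `r = numOuter Γ`. -/
def outer (Γ : Finset Pair) (i : ℕ) : Pair := pairAt (maximalPairs Γ) i

/-- The number `r` of outermost pairs. -/
def numOuter (Γ : Finset Pair) : ℕ := (maximalPairs Γ).card

/-- The inequality system for the shifts `γ 2, …, γ r` between the outermost pairs; there is no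
enclosing pair here, hence no terms with index `0`. -/
def IsOuterShift (c : ℝ → ℝ → ℝ) (Γ : Finset Pair) (γ : ℕ → ℝ) : Prop :=
  let C : ℕ → ℕ → ℝ := fun i j => c (outer Γ i).1 (outer Γ j).2
  ∀ n m : ℕ, 1 ≤ n → n < m → m ≤ numOuter Γ →
    -C m n + C n n ≤ ∑ k ∈ Finset.Icc (n + 1) m, γ k ∧
      ∑ k ∈ Finset.Icc (n + 1) m, γ k ≤ C n m - C m m

/-- The global potential `φ`, assembled from the potentials of the outermost pairs.  If there is
only one outermost pair, then `φ` is the potential of that pair. -/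
def IsGlobalPotential (X Z : Finset ℝ) (Γ : Finset Pair) (γ : ℕ → ℝ) (Φ : Pair → ℝ → ℝ)
    (φ : ℝ → ℝ) : Prop :=
  ∀ i ∈ Finset.Icc 1 (numOuter Γ), ∀ s ∈ skillGroup X Z (outer Γ i),
    φ s = Φ (outer Γ i) s + ∑ k ∈ Finset.Icc (i + 1) (numOuter Γ), γ k
      + Φ (outer Γ (numOuter Γ)) (outer Γ (numOuter Γ)).1 - Φ (outer Γ i) (outer Γ i).1

/-- `φ` is an output of the mechanism, for the choices `β` of the shifts at the pairs, with
resulting local potentials `Φ`. -/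
def IsOutput (c : ℝ → ℝ → ℝ) (X Z : Finset ℝ) (Γ : Finset Pair) (β : Pair → ℕ → ℝ)
    (Φ : Pair → ℝ → ℝ) (φ : ℝ → ℝ) : Prop :=
  Execution c X Z Γ Γ β Φ ∧
    ∃ γ : ℕ → ℝ, IsOuterShift c Γ γ ∧ IsGlobalPotential X Z Γ γ Φ φ

end

/-! ### Inequalities for mismatch costs -/

/-! Three consequences of optimality and concavity carry the proof.

Duality: an optimal assignment is cyclically monotone (`IsOptimallyAssigned.sum_cost_le`), so
shortest-path potentials supply wages and prices indexed by the pairs of `Γ`, tight at each pair and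
feasible across pairs (`IsOptimallyAssigned.exists_dual`). Wage differences between consecutive
subpairs then solve the shift systems, which makes them feasible. With the irrelevant coordinates
set to zero the solution set of (1) is compact, hence has a lexicographic minimum.

Geometry: two crossing pairs would gain from exchanging partners, by strict concavity if they point
the same way and by monotonicity otherwise. So the pairs of `Γ` are nested or separated, and form
layers.

Uncrossing: for a worker inside the interval of a pair and a job outside it (or conversely), serving
them through the pair costs no more than serving them directly (`IsUncrossing`). Hence, if a
potential is feasible and tight inside two separated groups, all constraints from workers of the
first to jobs of the second follow from the single one between the worker of the first enclosing
pair and the job of the second (`IsLayered.sub_le_of_separated`). The terms of (1) without index 0,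
and all of (2), state exactly these constraints. The terms with index 0 place every lower bound on
`φ(z₀)` below every upper bound, so the maximum and the minimum in the mechanism are both
admissible.

Groups can overlap only in shared endpoints, where opposite constraints force equality; this makes
the formulas consistent. Induction on the number of pairs inside an interval shows that every
computed potential is a local dual optimizer, and weak duality makes the output optimal. Later steps
only add constants on a group, so relative wages there are final. Since a skill group consists of
the members of the pairs inside it, the whole computation is local. -/

theorem StrictConcaveOn.add_lt_add_of_add_eq {A : Set ℝ} {f : ℝ → ℝ} (hf : StrictConcaveOn ℝ A f)
    {u v a b : ℝ} (hu : u ∈ A) (hv : v ∈ A) (hua : u < a) (hav : a < v) (hsum : a + b = u + v) :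
    f u + f v < f a + f b := by
  have hd : 0 < v - u := by linarith
  have hd' : v - u ≠ 0 := hd.ne'
  -- `a` and `b` are the convex combinations of `u` and `v` with exchanged weights, so adding the
  -- two concavity inequalities restores `f u + f v`.
  have hl : 0 < (v - a) / (v - u) := div_pos (by linarith) hd
  have hm : 0 < (a - u) / (v - u) := div_pos (by linarith) hd
  have h1 : (v - a) / (v - u) + (a - u) / (v - u) = 1 := by field_simp; ring
  have h2 : (v - a) / (v - u) * u + (a - u) / (v - u) * v = a := by field_simp; ring
  have h3 : (a - u) / (v - u) * u + (v - a) / (v - u) * v = b := by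
    obtain rfl : b = u + v - a := by linarith
    field_simp; ring
  have e1 := hf.2 hu hv (by linarith) hl hm h1
  have e2 := hf.2 hu hv (by linarith) hm hl (by linarith)
  simp only [smul_eq_mul, h2, h3] at e1 e2
  have e3 : (v - a) / (v - u) * f u + (a - u) / (v - u) * f v
      + ((a - u) / (v - u) * f u + (v - a) / (v - u) * f v) = f u + f v := by
    field_simp; ring
  linarith

/-- Reflection exchanges under- and overqualification, so pairs with `P.2 ≤ P.1` reduce to pairs
with `P.1 ≤ P.2`. -/
theorem IsMismatchProfile.reflect {h : ℝ → ℝ} (hh : IsMismatchProfile h) :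
    IsMismatchProfile fun t => h (-t) where
  zero := by simpa using hh.zero
  concave_right := by
    refine ⟨convex_Ici 0, fun x hx y hy hxy a b ha hb hab => ?_⟩
    have := hh.concave_left.2 (x := -x) (y := -y) (by simpa using hx) (by simpa using hy)
      (by simpa using hxy) ha hb hab
    simpa [add_comm] using this
  mono_right := fun x hx y hy hxy =>
    hh.anti_left (a := -y) (b := -x) (by simpa using hy) (by simpa using hx) (by linarith)
  concave_left := by
    refine ⟨convex_Iic 0, fun x hx y hy hxy a b ha hb hab => ?_⟩
    have := hh.concave_right.2 (x := -x) (y := -y) (by simpa using hx) (by simpa using hy)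
      (by simpa using hxy) ha hb hab
    simpa [add_comm] using this
  anti_left := fun x hx y hy hxy =>
    hh.mono_right (a := -y) (b := -x) (by simpa using hy) (by simpa using hx) (by linarith)

/-- `s` is not strictly between the two members of the pair `P`. -/
def IsOutside (s : ℝ) (P : Pair) : Prop := s ≤ min P.1 P.2 ∨ max P.1 P.2 ≤ s

/-- The intervals of `P` and `Q` have no interior point in common. -/
def AreSeparated (P Q : Pair) : Prop :=
  max P.1 P.2 ≤ min Q.1 Q.2 ∨ max Q.1 Q.2 ≤ min P.1 P.2

/-- Splitting the pair `P` to serve somebody inside its interval and somebody outside costs at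
least as much as serving these two by each other. -/
structure IsUncrossing (c : ℝ → ℝ → ℝ) : Prop where
  worker : ∀ (P : Pair) (x z : ℝ), x ∈ interval P → IsOutside z P →
    c x P.2 + c P.1 z ≤ c x z + c P.1 P.2
  job : ∀ (P : Pair) (x z : ℝ), z ∈ interval P → IsOutside x P →
    c P.1 z + c x P.2 ≤ c x z + c P.1 P.2

theorem mem_interval_iff {P : Pair} {s : ℝ} :
    s ∈ interval P ↔ min P.1 P.2 ≤ s ∧ s ≤ max P.1 P.2 := Iff.rfl

theorem interval_subset_iff {P Q : Pair} :
    interval Q ⊆ interval P ↔ min P.1 P.2 ≤ min Q.1 Q.2 ∧ max Q.1 Q.2 ≤ max P.1 P.2 :=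
  Set.uIcc_subset_uIcc_iff_le

theorem fst_mem_interval (P : Pair) : P.1 ∈ interval P := Set.left_mem_uIcc

theorem snd_mem_interval (P : Pair) : P.2 ∈ interval P := Set.right_mem_uIcc

/-- With `z` beyond `p`, both terms compare separately by monotonicity. With `z` beyond `q`, the
gaps `q - p` and `z - x` lie between `q - x` and `z - p` and have the same sum, so concavity
applies. -/
theorem IsMismatchProfile.add_le_add_of_outside {h : ℝ → ℝ} (hh : IsMismatchProfile h)
    {p q x z : ℝ} (hpx : p ≤ x) (hxq : x ≤ q) (hz : z ≤ p ∨ q ≤ z) :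
    h (q - x) + h (z - p) ≤ h (z - x) + h (q - p) := by
  rcases hz with hz | hz
  · have h1 : h (z - p) ≤ h (z - x) :=
      hh.anti_left.antitoneOn (Set.mem_Iic.2 (by linarith)) (Set.mem_Iic.2 (by linarith))
        (by linarith)
    have h2 : h (q - x) ≤ h (q - p) :=
      hh.mono_right.monotoneOn (Set.mem_Ici.2 (by linarith)) (Set.mem_Ici.2 (by linarith))
        (by linarith)
    linarith
  · rcases hz.eq_or_lt with rfl | hz
    · exact le_rfl
    rcases hpx.eq_or_lt with rfl | hpx
    · exact (add_comm _ _).le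
    have := hh.concave_right.add_lt_add_of_add_eq (u := q - x) (v := z - p) (a := q - p)
      (b := z - x) (Set.mem_Ici.2 (by linarith)) (Set.mem_Ici.2 (by linarith)) (by linarith)
      (by linarith) (by ring)
    linarith

/-- All four cases come from one inequality by symmetry: negating positions, or exchanging workers
with jobs, reflects the profile, and doing both preserves `z - x`. -/
theorem IsMismatchProfile.isUncrossing {h : ℝ → ℝ} (hh : IsMismatchProfile h) {c : ℝ → ℝ → ℝ}
    (hc : ∀ x z, c x z = h (z - x)) : IsUncrossing c where
  worker := by
    intro P x z hx hz
    simp only [hc]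
    rw [mem_interval_iff] at hx
    rw [IsOutside] at hz
    rcases le_total P.1 P.2 with hP | hP
    · rw [min_eq_left hP, max_eq_right hP] at *
      exact hh.add_le_add_of_outside hx.1 hx.2 hz
    · rw [min_eq_right hP, max_eq_left hP] at *
      have := hh.reflect.add_le_add_of_outside (p := -P.1) (q := -P.2) (x := -x) (z := -z)
        (by linarith) (by linarith) (by rcases hz with hz | hz; right; linarith; left; linarith)
      simpa [add_comm, sub_eq_add_neg] using this
  job := by
    intro P x z hz hx
    simp only [hc]
    rw [mem_interval_iff] at hz
    rw [IsOutside] at hx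
    rcases le_total P.1 P.2 with hP | hP
    · rw [min_eq_left hP, max_eq_right hP] at *
      have := hh.add_le_add_of_outside (p := -P.2) (q := -P.1) (x := -z) (z := -x)
        (by linarith) (by linarith) (by rcases hx with hx | hx; right; linarith; left; linarith)
      convert this using 3 <;> ring
    · rw [min_eq_right hP, max_eq_left hP] at *
      have := hh.reflect.add_le_add_of_outside hz.1 hz.2 hx
      simpa using this

/-- For crossing pairs of equal orientation the exchange spreads the two gaps apart at constant sum,
which strict concavity rewards. For opposite orientations it shortens both gaps. -/
theorem IsMismatchProfile.add_lt_add_of_crossing {h : ℝ → ℝ} (hh : IsMismatchProfile h)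
    {p q x z : ℝ} (hpm : p < min x z) (hmq : min x z < q) (hqM : q < max x z) :
    h (z - p) + h (q - x) < h (q - p) + h (z - x) := by
  rcases le_total x z with hxz | hxz
  · rw [min_eq_left hxz, max_eq_right hxz] at *
    have := hh.concave_right.add_lt_add_of_add_eq (u := q - x) (v := z - p) (a := q - p)
      (b := z - x) (Set.mem_Ici.2 (by linarith)) (Set.mem_Ici.2 (by linarith)) (by linarith)
      (by linarith) (by ring)
    linarith
  · rw [min_eq_right hxz, max_eq_left hxz] at *
    have h1 : h (z - p) < h (q - p) :=
      hh.mono_right (Set.mem_Ici.2 (by linarith)) (Set.mem_Ici.2 (by linarith)) (by linarith)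
    have h2 : h (q - x) < h (z - x) :=
      hh.anti_left (Set.mem_Iic.2 (by linarith)) (Set.mem_Iic.2 (by linarith)) (by linarith)
    linarith

theorem IsMismatchProfile.cost_lt_of_crossing {h : ℝ → ℝ} (hh : IsMismatchProfile h)
    {c : ℝ → ℝ → ℝ} (hc : ∀ x z, c x z = h (z - x)) {P Q : Pair}
    (h1 : min P.1 P.2 < min Q.1 Q.2) (h2 : min Q.1 Q.2 < max P.1 P.2)
    (h3 : max P.1 P.2 < max Q.1 Q.2) :
    c P.1 Q.2 + c Q.1 P.2 < c P.1 P.2 + c Q.1 Q.2 := by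
  simp only [hc]
  rcases le_total P.1 P.2 with hP | hP
  · rw [min_eq_left hP, max_eq_right hP] at *
    exact hh.add_lt_add_of_crossing h1 h2 h3
  · rw [min_eq_right hP, max_eq_left hP] at *
    rw [min_comm] at h1 h2
    rw [max_comm] at h3
    have := hh.reflect.add_lt_add_of_crossing h1 h2 h3
    simp only [neg_sub] at this
    linarith

/-- Pairs that do not gain from exchanging partners are nested or separated. -/
theorem IsMismatchProfile.nested_or_separated {h : ℝ → ℝ} (hh : IsMismatchProfile h)
    {c : ℝ → ℝ → ℝ} (hc : ∀ x z, c x z = h (z - x)) {P Q : Pair}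
    (hPQ : c P.1 P.2 + c Q.1 Q.2 ≤ c P.1 Q.2 + c Q.1 P.2) :
    interval P ⊆ interval Q ∨ interval Q ⊆ interval P ∨ AreSeparated P Q := by
  by_contra hcon
  simp only [interval_subset_iff, AreSeparated] at hcon
  push Not at hcon
  obtain ⟨hPQ', hQP', hs1, hs2⟩ := hcon
  rcases lt_or_ge (min P.1 P.2) (min Q.1 Q.2) with hlt | hge
  · have := hh.cost_lt_of_crossing hc hlt hs1 (hQP' hlt.le)
    linarith
  · have h3 := hPQ' hge
    rcases hge.eq_or_lt with heq | hlt
    · exact absurd (hQP' heq.ge) (not_lt.2 h3.le)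
    · have := hh.cost_lt_of_crossing hc hlt hs2 h3
      linarith

/-! ### Finitely supported measures and optimal assignments -/

section FiniteSupport

variable {α : Type*} [MeasurableSpace α] {μ : Measure α} {A : Finset α}

theorem HasFiniteSupport.ae_mem (hμ : HasFiniteSupport μ A) : ∀ᵐ a ∂μ, a ∈ A :=
  mem_ae_iff.2 hμ.compl

variable [MeasurableSingletonClass α]

theorem MeasureTheory.Measure.integrable_of_finset_compl_eq_zero [IsFiniteMeasure μ]
    (hA : μ ((A : Set α)ᶜ) = 0) (f : α → ℝ) : Integrable f μ := by
  have h : μ.restrict (A : Set α) = μ :=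
    Measure.restrict_eq_self_of_ae_mem (mem_ae_iff.2 hA)
  rw [← h]
  exact (IntegrableOn.of_finite A.finite_toSet : IntegrableOn f (A : Set α) μ)

theorem HasFiniteSupport.integrable [IsFiniteMeasure μ] (hμ : HasFiniteSupport μ A) (f : α → ℝ) :
    Integrable f μ :=
  Measure.integrable_of_finset_compl_eq_zero hμ.compl f

end FiniteSupport

section Assignment

variable {c : ℝ → ℝ → ℝ} {F G : Measure ℝ} {X Z : Finset ℝ} {π : Measure Pair} {Γ : Finset Pair}

theorem IsOptimallyAssigned.isFiniteMeasure (hπ : IsOptimallyAssigned c F G X Z π Γ) :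
    IsFiniteMeasure π := by
  have := hπ.finite_F
  rw [← hπ.optimal.1.1] at this
  exact Measure.isFiniteMeasure_of_map measurable_fst.aemeasurable

theorem IsOptimallyAssigned.measure_fst_preimage (hπ : IsOptimallyAssigned c F G X Z π Γ)
    {s : Set ℝ} (hs : MeasurableSet s) : π (Prod.fst ⁻¹' s) = F s := by
  rw [← hπ.optimal.1.1, Measure.map_apply measurable_fst hs]

theorem IsOptimallyAssigned.measure_snd_preimage (hπ : IsOptimallyAssigned c F G X Z π Γ)
    {s : Set ℝ} (hs : MeasurableSet s) : π (Prod.snd ⁻¹' s) = G s := by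
  rw [← hπ.optimal.1.2, Measure.map_apply measurable_snd hs]

theorem IsOptimallyAssigned.fst_mem (hπ : IsOptimallyAssigned c F G X Z π Γ) {P : Pair}
    (hP : P ∈ Γ) : P.1 ∈ X := by
  rw [hπ.supp_F.mem_iff, ← hπ.measure_fst_preimage (measurableSet_singleton _)]
  exact ((hπ.pairs P).1 hP).trans_le (measure_mono (by simp))

theorem IsOptimallyAssigned.snd_mem (hπ : IsOptimallyAssigned c F G X Z π Γ) {P : Pair}
    (hP : P ∈ Γ) : P.2 ∈ Z := by
  rw [hπ.supp_G.mem_iff, ← hπ.measure_snd_preimage (measurableSet_singleton _)]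
  exact ((hπ.pairs P).1 hP).trans_le (measure_mono (by simp))

theorem IsOptimallyAssigned.hasFiniteSupport (hπ : IsOptimallyAssigned c F G X Z π Γ) :
    HasFiniteSupport π Γ where
  mem_iff := hπ.pairs
  compl := by
    have h1 : π (Prod.fst ⁻¹' (X : Set ℝ)ᶜ) = 0 := by
      rw [hπ.measure_fst_preimage X.measurableSet.compl, hπ.supp_F.compl]
    have h2 : π (Prod.snd ⁻¹' (Z : Set ℝ)ᶜ) = 0 := by
      rw [hπ.measure_snd_preimage Z.measurableSet.compl, hπ.supp_G.compl]
    have h3 : π (⋃ P ∈ (((X ×ˢ Z) \ Γ : Finset Pair) : Set Pair), {P}) = 0 := by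
      rw [measure_biUnion_null_iff (Finset.countable_toSet _)]
      intro P hP
      have := mt (hπ.pairs P).2 (Finset.mem_sdiff.1 hP).2
      simpa using this
    refine measure_mono_null (fun P hP => ?_) (measure_union_null (measure_union_null h1 h2) h3)
    by_cases hX : P.1 ∈ X <;> by_cases hZ : P.2 ∈ Z <;> simp_all

theorem IsOptimallyAssigned.exists_job (hπ : IsOptimallyAssigned c F G X Z π Γ) {x : ℝ}
    (hx : x ∈ X) : ∃ z, (x, z) ∈ Γ := by
  by_contra! hcon
  rw [hπ.supp_F.mem_iff, ← hπ.measure_fst_preimage (measurableSet_singleton _)] at hx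
  refine hx.ne' (measure_mono_null ?_ hπ.hasFiniteSupport.compl)
  rintro ⟨x', z⟩ rfl
  exact hcon z

theorem IsOptimallyAssigned.exists_worker (hπ : IsOptimallyAssigned c F G X Z π Γ) {z : ℝ}
    (hz : z ∈ Z) : ∃ x, (x, z) ∈ Γ := by
  by_contra! hcon
  rw [hπ.supp_G.mem_iff, ← hπ.measure_snd_preimage (measurableSet_singleton _)] at hz
  refine hz.ne' (measure_mono_null ?_ hπ.hasFiniteSupport.compl)
  rintro ⟨x, z'⟩ rfl
  exact hcon x

/-- Cyclical monotonicity: reassigning the jobs of finitely many pairs does not pay. -/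
theorem IsOptimallyAssigned.sum_cost_le (hπ : IsOptimallyAssigned c F G X Z π Γ) {ι : Type*}
    [Fintype ι] (f : ι → Pair) (hf : ∀ i, f i ∈ Γ) (σ : Equiv.Perm ι) :
    ∑ i, c (f i).1 (f i).2 ≤ ∑ i, c (f i).1 (f (σ i)).2 := by
  have := hπ.isFiniteMeasure
  -- The family `f` may repeat a pair up to `Fintype.card ι` times, so each atom must be able to
  -- give up that many portions `ε`. The minimum with 1 keeps `ε` finite if `Γ` is empty; the `+ 1`
  -- below avoids division by zero if `ι` is.
  obtain ⟨ε, hε0, hεtop, hε⟩ : ∃ ε : ENNReal, ε ≠ 0 ∧ ε ≠ ⊤ ∧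
      ∀ P ∈ Γ, Fintype.card ι * ε ≤ π {P} := by
    have hm : 0 < min 1 (Γ.inf fun P => π {P}) :=
      lt_min one_pos ((Finset.lt_inf_iff (by simp)).2 fun P hP => (hπ.pairs P).1 hP)
    refine ⟨min 1 (Γ.inf fun P => π {P}) / (Fintype.card ι + 1),
      (ENNReal.div_pos hm.ne' (by finiteness)).ne',
      ENNReal.div_ne_top (ne_top_of_le_ne_top ENNReal.one_ne_top (min_le_left _ _)) (by simp),
      fun P hP => ?_⟩
    calc _ ≤ ((Fintype.card ι : ENNReal) + 1)
          * (min 1 (Γ.inf fun P => π {P}) / (Fintype.card ι + 1)) := by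
            gcongr; exact le_self_add
      _ = min 1 (Γ.inf fun P => π {P}) :=
          ENNReal.mul_div_cancel (by simp) (by finiteness)
      _ ≤ π {P} := (min_le_right _ _).trans (Finset.inf_le hP)
  set μ : Measure Pair := ∑ i, ε • Measure.dirac (f i) with hμ
  set ν : Measure Pair := ∑ i, ε • Measure.dirac ((f i).1, (f (σ i)).2) with hν
  have hμfin : IsFiniteMeasure μ := ⟨by
    simpa [hμ, Measure.finsetSum_apply] using
      ENNReal.mul_lt_top (by simp) (lt_top_iff_ne_top.2 hεtop)⟩
  have hνfin : IsFiniteMeasure ν := ⟨by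
    simpa [hν, Measure.finsetSum_apply] using
      ENNReal.mul_lt_top (by simp) (lt_top_iff_ne_top.2 hεtop)⟩
  have hle : μ ≤ π := by
    refine Measure.le_iff.2 fun s hs => ?_
    by_cases hsf : ∃ i, f i ∈ s
    · obtain ⟨i, hi⟩ := hsf
      calc μ s ≤ ∑ i : ι, ε := by
            rw [hμ, Measure.finsetSum_apply]
            refine Finset.sum_le_sum fun j _ => ?_
            rw [Measure.smul_apply, smul_eq_mul]
            exact mul_le_of_le_one_right' prob_le_one
        _ = Fintype.card ι * ε := by simp
        _ ≤ π {f i} := hε _ (hf i)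
        _ ≤ π s := measure_mono (by simpa using hi)
    · push Not at hsf
      have : μ s = 0 := by
        simp [hμ, Measure.finsetSum_apply, Measure.dirac_apply' _ hs, hsf]
      rw [this]
      exact zero_le
  have hsub : π - μ + μ = π := Measure.sub_add_cancel_of_le hle
  have hfst : ν.map Prod.fst = μ.map Prod.fst := by
    ext s hs
    rw [Measure.map_apply measurable_fst hs, Measure.map_apply measurable_fst hs]
    simp only [hμ, hν, Measure.finsetSum_apply, Measure.smul_apply,
      Measure.dirac_apply' _ (measurable_fst hs)]
    rfl
  have hsnd : ν.map Prod.snd = μ.map Prod.snd := by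
    ext s hs
    rw [Measure.map_apply measurable_snd hs, Measure.map_apply measurable_snd hs]
    simp only [hμ, hν, Measure.finsetSum_apply, Measure.smul_apply,
      Measure.dirac_apply' _ (measurable_snd hs)]
    exact Equiv.sum_comp σ fun i => ε • (Prod.snd ⁻¹' s).indicator 1 (f i)
  -- The competitor removes mass `ε` at each `f i` and returns it with the jobs permuted by `σ`,
  -- which leaves both marginals unchanged.
  have hass : IsAssignment F G (π - μ + ν) := by
    constructor
    · rw [Measure.map_add _ _ measurable_fst, hfst, ← Measure.map_add _ _ measurable_fst, hsub,
        hπ.optimal.1.1]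
    · rw [Measure.map_add _ _ measurable_snd, hsnd, ← Measure.map_add _ _ measurable_snd, hsub,
        hπ.optimal.1.2]
  have hopt := hπ.optimal.2 _ hass
  have hint : Integrable (fun P : Pair => c P.1 P.2) (π - μ) :=
    (hπ.hasFiniteSupport.integrable _).mono_measure Measure.sub_le
  have hdirac : ∀ P : Pair, Integrable (fun P : Pair => c P.1 P.2) (ε • Measure.dirac P) :=
    fun P => (integrable_dirac (by finiteness)).smul_measure hεtop
  have hintμ : Integrable (fun P : Pair => c P.1 P.2) μ :=
    integrable_finsetSum_measure.2 fun i _ => hdirac _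
  have hintν : Integrable (fun P : Pair => c P.1 P.2) ν :=
    integrable_finsetSum_measure.2 fun i _ => hdirac _
  rw [← hsub, integral_add_measure (by simpa [hsub] using hint) hintμ] at hopt
  rw [hsub, integral_add_measure hint hintν, add_le_add_iff_left, hμ, hν,
    integral_finsetSum_measure fun i _ => hdirac _,
    integral_finsetSum_measure fun i _ => hdirac _] at hopt
  simp only [integral_smul_measure, integral_dirac, smul_eq_mul, ← Finset.mul_sum] at hopt
  exact le_of_mul_le_mul_left hopt (ENNReal.toReal_pos hε0 hεtop)

/-- Weak duality: a feasible potential that is tight at all pairs is optimal. -/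
theorem IsOptimallyAssigned.isOptimalDualPair (hπ : IsOptimallyAssigned c F G X Z π Γ)
    {φ : ℝ → ℝ} (hfeas : ∀ x ∈ X, ∀ z ∈ Z, φ x - φ z ≤ c x z)
    (htight : ∀ P ∈ Γ, φ P.1 - φ P.2 = c P.1 P.2) : IsOptimalDualPair c F G X Z φ (-φ) := by
  have := hπ.isFiniteMeasure
  have key : ∀ φ' ψ' : ℝ → ℝ,
      ∫ x, φ' x ∂F + ∫ z, ψ' z ∂G = ∫ P, (φ' P.1 + ψ' P.2) ∂π := by
    intro φ' ψ'
    have := hπ.finite_F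
    have := hπ.finite_G
    have h1 : ∫ x, φ' x ∂F = ∫ P, φ' P.1 ∂π := by
      have hi := (hπ.supp_F.integrable φ').aestronglyMeasurable
      rw [← hπ.optimal.1.1] at hi
      rw [← integral_map measurable_fst.aemeasurable hi, hπ.optimal.1.1]
    have h2 : ∫ z, ψ' z ∂G = ∫ P, ψ' P.2 ∂π := by
      have hi := (hπ.supp_G.integrable ψ').aestronglyMeasurable
      rw [← hπ.optimal.1.2] at hi
      rw [← integral_map measurable_snd.aemeasurable hi, hπ.optimal.1.2]
    rw [h1, h2, integral_add (hπ.hasFiniteSupport.integrable _)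
      (hπ.hasFiniteSupport.integrable _)]
  refine ⟨fun x hx z hz => by simpa [sub_eq_add_neg] using hfeas x hx z hz,
    fun φ' ψ' hφ' => ?_⟩
  rw [key, key]
  refine integral_mono_ae (hπ.hasFiniteSupport.integrable _) (hπ.hasFiniteSupport.integrable _) ?_
  filter_upwards [hπ.hasFiniteSupport.ae_mem] with P hP
  have h1 := hφ' P.1 (hπ.fst_mem hP) P.2 (hπ.snd_mem hP)
  have h2 := htight P hP
  simp only [Pi.neg_apply]
  linarith

end Assignment

/-! ### Dual potentials -/

/-- A system of difference constraints without negative cycles has a solution. -/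
theorem exists_potential_of_cycle_nonneg {ι : Type*} [Finite ι] (w : ι → ι → ℝ)
    (hw : ∀ (n : ℕ) (f : Fin (n + 1) → ι), 0 ≤ ∑ i, w (f i) (f (i + 1))) :
    ∃ v : ι → ℝ, ∀ i j, v i - v j ≤ w i j := by
  -- Closing a walk by the edge back to its start bounds its weight below; finiteness of `ι` then
  -- makes the bound uniform over all walks from a given vertex.
  have hcyc : ∀ (n : ℕ) (f : ℕ → ι),
      -w (f n) (f 0) ≤ ∑ k ∈ Finset.range n, w (f k) (f (k + 1)) := by
    intro n f
    have := hw n fun i => f i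
    rw [Fin.sum_univ_castSucc] at this
    simp only [Fin.val_castSucc, Fin.coeSucc_eq_succ, Fin.val_succ, Fin.val_last,
      Fin.last_add_one, Fin.val_zero] at this
    rw [Fin.sum_univ_eq_sum_range fun k => w (f k) (f (k + 1))] at this
    linarith
  let W : ι → Set ℝ := fun i =>
    {r | ∃ (n : ℕ) (f : ℕ → ι), f 0 = i ∧ r = ∑ k ∈ Finset.range n, w (f k) (f (k + 1))}
  have hbdd : ∀ i, BddBelow (W i) := by
    intro i
    obtain ⟨M, hM⟩ := (Set.finite_range fun j => w j i).bddAbove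
    refine ⟨-M, ?_⟩
    rintro _ ⟨n, f, rfl, rfl⟩
    exact (neg_le_neg (hM ⟨f n, rfl⟩)).trans (hcyc n f)
  have hne : ∀ i, (W i).Nonempty := fun i => ⟨0, 0, fun _ => i, rfl, by simp⟩
  -- The potential is the infimal weight of walks starting at `i`; prepending `i` to a walk from `j`
  -- gives the constraint.
  refine ⟨fun i => sInf (W i), fun i j => ?_⟩
  rw [sub_le_comm]
  refine le_csInf (hne j) ?_
  rintro _ ⟨n, f, rfl, rfl⟩
  rw [sub_le_iff_le_add']
  refine csInf_le (hbdd i) ⟨n + 1, fun k => Nat.casesOn k i f, rfl, ?_⟩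
  rw [Finset.sum_range_succ']
  simp [add_comm]

/-- There are wages `u` of the workers and prices `v` of the jobs that support the pairs of an
optimal assignment. -/
theorem IsOptimallyAssigned.exists_dual {c : ℝ → ℝ → ℝ} {F G : Measure ℝ} {X Z : Finset ℝ}
    {π : Measure Pair} {Γ : Finset Pair} (hπ : IsOptimallyAssigned c F G X Z π Γ) :
    ∃ u v : Pair → ℝ, (∀ P ∈ Γ, u P - v P = c P.1 P.2) ∧
      ∀ P ∈ Γ, ∀ Q ∈ Γ, u P - v Q ≤ c P.1 Q.2 := by
  classical
  -- The weight from `P` to `Q` is the extra cost of giving the worker of `P` the job of `Q`; a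
  -- cycle is the cyclic shift of its positions, so cyclical monotonicity applies. The potential
  -- provides the job prices, and tightness then defines the wages.
  obtain ⟨v, hv⟩ := exists_potential_of_cycle_nonneg
    (fun P Q : Γ => c P.1.1 Q.1.2 - c P.1.1 P.1.2) fun n f => by
      have := hπ.sum_cost_le (fun i => (f i : Pair)) (fun i => (f i).2) (Equiv.addRight 1)
      simpa using this
  let v' : Pair → ℝ := fun P => if hP : P ∈ Γ then v ⟨P, hP⟩ else 0
  refine ⟨fun P => v' P + c P.1 P.2, v', fun P _ => by simp, fun P hP Q hQ => ?_⟩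
  have := hv ⟨P, hP⟩ ⟨Q, hQ⟩
  simp only [v', hP, hQ, dif_pos]
  linarith

/-! ### Layers of pairs -/

/-- What the mechanism uses of an optimal assignment: its pairs cover the skill levels, are
pairwise nested or separated, and are supported by dual variables. -/
structure IsLayered (c : ℝ → ℝ → ℝ) (X Z : Finset ℝ) (Γ : Finset Pair) : Prop where
  disj : Disjoint X Z
  fst_mem : ∀ P ∈ Γ, P.1 ∈ X
  snd_mem : ∀ P ∈ Γ, P.2 ∈ Z
  exists_job : ∀ x ∈ X, ∃ z, (x, z) ∈ Γ
  exists_worker : ∀ z ∈ Z, ∃ x, (x, z) ∈ Γ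
  nested_or_separated : ∀ P ∈ Γ, ∀ Q ∈ Γ,
    interval P ⊆ interval Q ∨ interval Q ⊆ interval P ∨ AreSeparated P Q
  exists_dual : ∃ u v : Pair → ℝ, (∀ P ∈ Γ, u P - v P = c P.1 P.2) ∧
    ∀ P ∈ Γ, ∀ Q ∈ Γ, u P - v Q ≤ c P.1 Q.2
  uncrossing : IsUncrossing c

theorem IsOptimallyAssigned.isLayered {h : ℝ → ℝ} (hh : IsMismatchProfile h) {c : ℝ → ℝ → ℝ}
    (hc : ∀ x z, c x z = h (z - x)) {F G : Measure ℝ} {X Z : Finset ℝ} {π : Measure Pair}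
    {Γ : Finset Pair} (hπ : IsOptimallyAssigned c F G X Z π Γ) : IsLayered c X Z Γ where
  disj := hπ.disj
  fst_mem _ := hπ.fst_mem
  snd_mem _ := hπ.snd_mem
  exists_job _ := hπ.exists_job
  exists_worker _ := hπ.exists_worker
  nested_or_separated P hP Q hQ := by
    obtain ⟨u, v, huv, hle⟩ := hπ.exists_dual
    refine hh.nested_or_separated hc ?_
    linarith [huv P hP, huv Q hQ, hle P hP Q hQ, hle Q hQ P hP]
  exists_dual := hπ.exists_dual
  uncrossing := hh.isUncrossing hc

theorem AreSeparated.symm {P Q : Pair} (h : AreSeparated P Q) : AreSeparated Q P := Or.symm h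

theorem AreSeparated.isOutside {P Q : Pair} (h : AreSeparated P Q) {s : ℝ}
    (hs : s ∈ interval Q) : IsOutside s P :=
  h.elim (fun h => Or.inr (h.trans hs.1)) fun h => Or.inl (hs.2.trans h)

theorem AreSeparated.eq_of_mem {P Q : Pair} (h : AreSeparated P Q) {s : ℝ}
    (hP : s ∈ interval P) (hQ : s ∈ interval Q) : s = P.1 ∨ s = P.2 := by
  rw [mem_interval_iff] at hP hQ
  rcases h with h | h
  · rw [le_antisymm hP.2 (h.trans hQ.1)]
    exact max_choice _ _
  · rw [le_antisymm (hQ.2.trans h) hP.1]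
    exact min_choice _ _

theorem isOutside_of_interval_subset {P Q : Pair} (h : interval Q ⊆ interval P) {s : ℝ}
    (hs : s = P.1 ∨ s = P.2) : IsOutside s Q := by
  rw [interval_subset_iff] at h
  rcases le_total P.1 P.2 with hP | hP
  · rw [min_eq_left hP, max_eq_right hP] at h
    rcases hs with rfl | rfl
    exacts [Or.inl h.1, Or.inr h.2]
  · rw [min_eq_right hP, max_eq_left hP] at h
    rcases hs with rfl | rfl
    exacts [Or.inr h.2, Or.inl h.1]

theorem IsOutside.eq_of_mem {Q : Pair} {s : ℝ} (hs : IsOutside s Q) (hQ : s ∈ interval Q) :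
    s = Q.1 ∨ s = Q.2 := by
  rw [mem_interval_iff] at hQ
  rcases hs with h | h
  · rw [le_antisymm h hQ.1]
    exact min_choice _ _
  · rw [le_antisymm hQ.2 h]
    exact max_choice _ _

theorem mem_pairsWithin {Γ : Finset Pair} {P Q : Pair} :
    Q ∈ pairsWithin Γ P ↔ Q ∈ Γ ∧ interval Q ⊆ interval P := by
  simp [pairsWithin]

theorem pairsWithin_subset {Γ : Finset Pair} {P : Pair} : pairsWithin Γ P ⊆ Γ :=
  fun _ h => (mem_pairsWithin.1 h).1

theorem mem_maximalPairs {A : Finset Pair} {Q : Pair} :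
    Q ∈ maximalPairs A ↔ Q ∈ A ∧ ∀ R ∈ A, interval Q ⊆ interval R → R = Q := by
  simp [maximalPairs]

theorem self_mem_pairsWithin {Γ : Finset Pair} {P : Pair} (hP : P ∈ Γ) : P ∈ pairsWithin Γ P :=
  mem_pairsWithin.2 ⟨hP, subset_rfl⟩

theorem mem_pairsWithin_of_mem_subpairs {Γ : Finset Pair} {P Q : Pair} (hQ : Q ∈ subpairs Γ P) :
    Q ∈ pairsWithin Γ P :=
  Finset.mem_of_mem_erase (mem_maximalPairs.1 hQ).1

theorem ne_of_mem_subpairs {Γ : Finset Pair} {P Q : Pair} (hQ : Q ∈ subpairs Γ P) : Q ≠ P :=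
  Finset.ne_of_mem_erase (mem_maximalPairs.1 hQ).1

theorem mem_of_mem_subpairs {Γ : Finset Pair} {P Q : Pair} (hQ : Q ∈ subpairs Γ P) : Q ∈ Γ :=
  (mem_pairsWithin.1 (mem_pairsWithin_of_mem_subpairs hQ)).1

theorem interval_subset_of_mem_subpairs {Γ : Finset Pair} {P Q : Pair} (hQ : Q ∈ subpairs Γ P) :
    interval Q ⊆ interval P :=
  (mem_pairsWithin.1 (mem_pairsWithin_of_mem_subpairs hQ)).2

theorem pairsWithin_pairsWithin {Γ : Finset Pair} {P Q : Pair} (hQ : interval Q ⊆ interval P) :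
    pairsWithin (pairsWithin Γ P) Q = pairsWithin Γ Q := by
  ext R
  simp only [mem_pairsWithin]
  exact ⟨fun h => ⟨h.1.1, h.2⟩, fun h => ⟨⟨h.1, h.2.trans hQ⟩, h.2⟩⟩

namespace IsLayered

variable {c : ℝ → ℝ → ℝ} {X Z : Finset ℝ} {Γ : Finset Pair} {P Q : Pair} {s : ℝ}

theorem not_mem_job (hL : IsLayered c X Z Γ) (hs : s ∈ X) : s ∉ Z :=
  Finset.disjoint_left.1 hL.disj hs

theorem fst_ne_snd (hL : IsLayered c X Z Γ) (hP : P ∈ Γ) (hQ : Q ∈ Γ) : P.1 ≠ Q.2 :=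
  fun h => hL.not_mem_job (hL.fst_mem P hP) (h ▸ hL.snd_mem Q hQ)

theorem eq_fst (hL : IsLayered c X Z Γ) (hP : P ∈ Γ) (hs : s ∈ X) (h : s = P.1 ∨ s = P.2) :
    s = P.1 :=
  h.resolve_right fun h => hL.not_mem_job hs (h ▸ hL.snd_mem P hP)

theorem eq_snd (hL : IsLayered c X Z Γ) (hP : P ∈ Γ) (hs : s ∈ Z) (h : s = P.1 ∨ s = P.2) :
    s = P.2 :=
  h.resolve_left fun h => hL.not_mem_job (h ▸ hL.fst_mem P hP) hs

theorem swap_le (hL : IsLayered c X Z Γ) (hP : P ∈ Γ) (hQ : Q ∈ Γ) :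
    c P.1 P.2 + c Q.1 Q.2 ≤ c P.1 Q.2 + c Q.1 P.2 := by
  obtain ⟨u, v, huv, hle⟩ := hL.exists_dual
  linarith [huv P hP, huv Q hQ, hle P hP Q hQ, hle Q hQ P hP]

/-- Disjointness of `X` and `Z` excludes two pairs with the same endpoints and opposite
orientations, so inclusion of intervals is antisymmetric on `Γ`. -/
theorem eq_of_interval_eq (hL : IsLayered c X Z Γ) (hP : P ∈ Γ) (hQ : Q ∈ Γ)
    (h : interval P = interval Q) : P = Q := by
  have h1 : P.1 = Q.1 := hL.eq_fst hQ (hL.fst_mem P hP)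
    ((isOutside_of_interval_subset h.ge (Or.inl rfl)).eq_of_mem (h ▸ fst_mem_interval P))
  have h2 : P.2 = Q.2 := hL.eq_snd hQ (hL.snd_mem P hP)
    ((isOutside_of_interval_subset h.ge (Or.inr rfl)).eq_of_mem (h ▸ snd_mem_interval P))
  exact Prod.ext h1 h2

theorem exists_mem_maximalPairs (hL : IsLayered c X Z Γ) {A : Finset Pair} (hA : A ⊆ Γ)
    (hQ : Q ∈ A) : ∃ R ∈ maximalPairs A, interval Q ⊆ interval R := by
  classical
  -- A longest interval containing that of `Q` is maximal for inclusion.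
  obtain ⟨R, hR, hmax⟩ := (A.filter fun R => interval Q ⊆ interval R).exists_max_image
    (fun R => max R.1 R.2 - min R.1 R.2) ⟨Q, by simp [hQ]⟩
  simp only [Finset.mem_filter] at hR hmax
  refine ⟨R, mem_maximalPairs.2 ⟨hR.1, fun R' hR' hsub => ?_⟩, hR.2⟩
  have h1 := hmax R' ⟨hR', hR.2.trans hsub⟩
  have h2 := interval_subset_iff.1 hsub
  refine hL.eq_of_interval_eq (hA hR') (hA hR.1) (subset_antisymm ?_ hsub)
  rw [interval_subset_iff]
  constructor <;> linarith

theorem separated_of_mem_maximalPairs (hL : IsLayered c X Z Γ) {A : Finset Pair} (hA : A ⊆ Γ)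
    (hP : P ∈ maximalPairs A) (hQ : Q ∈ maximalPairs A) (hne : P ≠ Q) : AreSeparated P Q := by
  rw [mem_maximalPairs] at hP hQ
  rcases hL.nested_or_separated P (hA hP.1) Q (hA hQ.1) with h | h | h
  · exact absurd (hP.2 Q hQ.1 h).symm hne
  · exact absurd (hQ.2 P hP.1 h) hne
  · exact h

theorem fst_mem_skillGroup (hL : IsLayered c X Z Γ) (hP : P ∈ Γ) : P.1 ∈ skillGroup X Z P :=
  ⟨Or.inl (hL.fst_mem P hP), fst_mem_interval P⟩

theorem snd_mem_skillGroup (hL : IsLayered c X Z Γ) (hP : P ∈ Γ) : P.2 ∈ skillGroup X Z P :=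
  ⟨Or.inr (hL.snd_mem P hP), snd_mem_interval P⟩

/-- A pair of `Γ` having `s` as a member lies inside `P`, contains `P`, or is separated from it; in
the last two cases `s` must be an endpoint of `P`, and `P` itself serves. -/
theorem exists_mem_pairsWithin (hL : IsLayered c X Z Γ) (hP : P ∈ Γ)
    (hs : s ∈ skillGroup X Z P) : ∃ Q ∈ pairsWithin Γ P, s = Q.1 ∨ s = Q.2 := by
  have key : ∀ R ∈ Γ, (s = R.1 ∨ s = R.2) → ∃ Q ∈ pairsWithin Γ P, s = Q.1 ∨ s = Q.2 := by
    intro R hR hsR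
    have hsR' : s ∈ interval R := by
      rcases hsR with rfl | rfl
      exacts [fst_mem_interval R, snd_mem_interval R]
    rcases hL.nested_or_separated R hR P hP with h | h | h
    · exact ⟨R, mem_pairsWithin.2 ⟨hR, h⟩, hsR⟩
    · exact ⟨P, self_mem_pairsWithin hP, (isOutside_of_interval_subset h hsR).eq_of_mem hs.2⟩
    · exact ⟨P, self_mem_pairsWithin hP, h.symm.eq_of_mem hs.2 hsR'⟩
  rcases hs.1 with hX | hZ
  · obtain ⟨z, hz⟩ := hL.exists_job s hX
    exact key _ hz (Or.inl rfl)
  · obtain ⟨x, hx⟩ := hL.exists_worker s hZ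
    exact key _ hx (Or.inr rfl)

/-- A skill group consists of the members of the pairs within the group. -/
theorem skillGroup_eq (hL : IsLayered c X Z Γ) (hP : P ∈ Γ) :
    skillGroup X Z P = {s | ∃ Q ∈ pairsWithin Γ P, s = Q.1 ∨ s = Q.2} := by
  ext s
  refine ⟨hL.exists_mem_pairsWithin hP, ?_⟩
  rintro ⟨Q, hQ, rfl | rfl⟩ <;> rw [mem_pairsWithin] at hQ
  · exact ⟨Or.inl (hL.fst_mem Q hQ.1), hQ.2 (fst_mem_interval Q)⟩
  · exact ⟨Or.inr (hL.snd_mem Q hQ.1), hQ.2 (snd_mem_interval Q)⟩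

theorem exists_mem_subpairs (hL : IsLayered c X Z Γ) (hQ : Q ∈ pairsWithin Γ P) (hne : Q ≠ P) :
    ∃ R ∈ subpairs Γ P, interval Q ⊆ interval R :=
  hL.exists_mem_maximalPairs ((Finset.erase_subset _ _).trans pairsWithin_subset)
    (Finset.mem_erase.2 ⟨hne, hQ⟩)

theorem eq_or_mem_subpair (hL : IsLayered c X Z Γ) (hP : P ∈ Γ) (hs : s ∈ skillGroup X Z P) :
    s = P.1 ∨ s = P.2 ∨ ∃ Q ∈ subpairs Γ P, s ∈ skillGroup X Z Q := by
  obtain ⟨Q, hQ, hsQ⟩ := hL.exists_mem_pairsWithin hP hs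
  by_cases hne : Q = P
  · subst hne
    tauto
  · obtain ⟨R, hR, hQR⟩ := hL.exists_mem_subpairs hQ hne
    refine Or.inr (Or.inr ⟨R, hR, hs.1, hQR ?_⟩)
    rcases hsQ with rfl | rfl
    exacts [fst_mem_interval Q, snd_mem_interval Q]

theorem exists_mem_outermost (hL : IsLayered c X Z Γ) (hs : s ∈ X ∨ s ∈ Z) :
    ∃ Q ∈ maximalPairs Γ, s ∈ skillGroup X Z Q := by
  obtain ⟨R, hR, hsR⟩ : ∃ R ∈ Γ, s ∈ interval R := by
    rcases hs with hX | hZ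
    · obtain ⟨z, hz⟩ := hL.exists_job s hX
      exact ⟨_, hz, fst_mem_interval (s, z)⟩
    · obtain ⟨x, hx⟩ := hL.exists_worker s hZ
      exact ⟨_, hx, snd_mem_interval (x, s)⟩
  obtain ⟨Q, hQ, hRQ⟩ := hL.exists_mem_maximalPairs subset_rfl hR
  exact ⟨Q, hQ, hs, hRQ hsR⟩

theorem separated_of_mem_subpairs (hL : IsLayered c X Z Γ) {R : Pair} (hP : P ∈ subpairs Γ R)
    (hQ : Q ∈ subpairs Γ R) (hne : P ≠ Q) : AreSeparated P Q :=
  hL.separated_of_mem_maximalPairs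
    ((Finset.erase_subset _ _).trans pairsWithin_subset) hP hQ hne

/-- The number of pairs inside an interval is the measure for every induction over the layers. -/
theorem card_pairsWithin_lt (hL : IsLayered c X Z Γ) (hP : P ∈ Γ) (hQ : Q ∈ pairsWithin Γ P)
    (hne : Q ≠ P) : (pairsWithin Γ Q).card < (pairsWithin Γ P).card := by
  rw [mem_pairsWithin] at hQ
  refine Finset.card_lt_card (Finset.ssubset_iff_of_subset (fun R hR => ?_) |>.2
    ⟨P, self_mem_pairsWithin hP, fun h => hne ?_⟩)
  · rw [mem_pairsWithin] at hR ⊢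
    exact ⟨hR.1, hR.2.trans hQ.2⟩
  · exact hL.eq_of_interval_eq hQ.1 hP (hQ.2.antisymm (mem_pairsWithin.1 h).2)

end IsLayered

/-! ### Enumeration in dictionary order -/

theorem pairAt_eq_getElem {A : Finset Pair} {i : ℕ} (hi : i ∈ Finset.Icc 1 A.card) :
    ∃ h : i - 1 < ((A.map toLex.toEmbedding).sort (· ≤ ·)).length,
      toLex (pairAt A i) = ((A.map toLex.toEmbedding).sort (· ≤ ·))[i - 1] := by
  rw [Finset.mem_Icc] at hi
  have h : i - 1 < ((A.map toLex.toEmbedding).sort (· ≤ ·)).length := by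
    rw [Finset.length_sort, Finset.card_map]
    omega
  exact ⟨h, by rw [pairAt, toLex_ofLex, List.getD_eq_getElem _ _ h]⟩

theorem pairAt_mem {A : Finset Pair} {i : ℕ} (hi : i ∈ Finset.Icc 1 A.card) : pairAt A i ∈ A := by
  obtain ⟨h, he⟩ := pairAt_eq_getElem hi
  have := (Finset.mem_sort (· ≤ ·)).1 (List.getElem_mem h)
  rw [← he] at this
  simpa using this

theorem pairAt_injOn {A : Finset Pair} {i j : ℕ} (hi : i ∈ Finset.Icc 1 A.card)
    (hj : j ∈ Finset.Icc 1 A.card) (h : pairAt A i = pairAt A j) : i = j := by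
  obtain ⟨h1, he1⟩ := pairAt_eq_getElem hi
  obtain ⟨h2, he2⟩ := pairAt_eq_getElem hj
  rw [h, he2] at he1
  have := (Finset.sort_nodup _ _).getElem_inj_iff.1 he1
  rw [Finset.mem_Icc] at hi hj
  omega

theorem exists_pairAt_eq {A : Finset Pair} {P : Pair} (hP : P ∈ A) :
    ∃ i ∈ Finset.Icc 1 A.card, pairAt A i = P :=
  Finset.surj_on_of_inj_on_of_card_le (s := Finset.Icc 1 A.card) (t := A)
    (fun i _ => pairAt A i) (fun _ hi => pairAt_mem hi) (fun _ _ hi hj h => pairAt_injOn hi hj h)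
    (by simp) P hP |>.imp fun i hi => ⟨hi.1, hi.2.symm⟩

theorem node_zero (Γ : Finset Pair) (P : Pair) : node Γ P 0 = P := rfl

theorem node_eq_pairAt {Γ : Finset Pair} {P : Pair} {i : ℕ}
    (hi : i ∈ Finset.Icc 1 (numSub Γ P)) : node Γ P i = pairAt (subpairs Γ P) i :=
  if_neg (by rw [Finset.mem_Icc] at hi; omega)

theorem node_mem {Γ : Finset Pair} {P : Pair} {i : ℕ} (hi : i ∈ Finset.Icc 1 (numSub Γ P)) :
    node Γ P i ∈ subpairs Γ P := by
  rw [node_eq_pairAt hi]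
  exact pairAt_mem hi

theorem exists_node_eq {Γ : Finset Pair} {P Q : Pair} (hQ : Q ∈ subpairs Γ P) :
    ∃ i ∈ Finset.Icc 1 (numSub Γ P), node Γ P i = Q := by
  obtain ⟨i, hi, rfl⟩ := exists_pairAt_eq hQ
  exact ⟨i, hi, node_eq_pairAt hi⟩

/-- The pairs `N 1, …, N p` are pairwise separated pairs of `Γ`. -/
structure IsSeparatedFamily (Γ : Finset Pair) (N : ℕ → Pair) (p : ℕ) : Prop where
  mem : ∀ i ∈ Finset.Icc 1 p, N i ∈ Γ
  separated : ∀ i ∈ Finset.Icc 1 p, ∀ j ∈ Finset.Icc 1 p, i ≠ j → AreSeparated (N i) (N j)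

theorem IsLayered.isSeparatedFamily_node {c : ℝ → ℝ → ℝ} {X Z : Finset ℝ} {Γ : Finset Pair}
    (hL : IsLayered c X Z Γ) (P : Pair) : IsSeparatedFamily Γ (node Γ P) (numSub Γ P) where
  mem i hi := mem_of_mem_subpairs (node_mem hi)
  separated i hi j hj hij := hL.separated_of_mem_subpairs (node_mem hi) (node_mem hj) fun h =>
    hij (pairAt_injOn hi hj (by rwa [node_eq_pairAt hi, node_eq_pairAt hj] at h))

theorem IsLayered.isSeparatedFamily_outer {c : ℝ → ℝ → ℝ} {X Z : Finset ℝ} {Γ : Finset Pair}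
    (hL : IsLayered c X Z Γ) : IsSeparatedFamily Γ (outer Γ) (numOuter Γ) where
  mem _ hi := (mem_maximalPairs.1 (pairAt_mem hi)).1
  separated _ hi _ hj hij := hL.separated_of_mem_maximalPairs subset_rfl (pairAt_mem hi)
    (pairAt_mem hj) fun h => hij (pairAt_injOn hi hj h)

/-! ### Gluing local dual optimizers -/

theorem IsLocalDual.of_eqOn_add {c : ℝ → ℝ → ℝ} {X Z : Finset ℝ} {Γ : Finset Pair} {A : Set ℝ}
    {φ φ' : ℝ → ℝ} (hφ : IsLocalDual c X Z Γ A φ) (a : ℝ) (h : ∀ s, φ' s = φ s + a) :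
    IsLocalDual c X Z Γ A φ' := by
  intro x hx z hz hxA hzA
  rw [h, h, add_sub_add_right_eq_sub]
  exact hφ x hx z hz hxA hzA

theorem IsLocalDual.sub_le {c : ℝ → ℝ → ℝ} {X Z : Finset ℝ} {Γ : Finset Pair} {P : Pair}
    {φ : ℝ → ℝ} (hφ : IsLocalDual c X Z Γ (skillGroup X Z P) φ) {x z : ℝ} (hx : x ∈ X)
    (hxP : x ∈ interval P) (hz : z ∈ Z) (hzP : z ∈ interval P) : φ x - φ z ≤ c x z :=
  (hφ x hx z hz ⟨Or.inl hx, hxP⟩ ⟨Or.inr hz, hzP⟩).1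

namespace IsLayered

variable {c : ℝ → ℝ → ℝ} {X Z : Finset ℝ} {Γ : Finset Pair} {P Q : Pair} {s : ℝ} {V W : ℝ → ℝ}

theorem sub_eq (hL : IsLayered c X Z Γ) (hQ : Q ∈ Γ) (hQP : interval Q ⊆ interval P)
    (hV : IsLocalDual c X Z Γ (skillGroup X Z P) V) : V Q.1 - V Q.2 = c Q.1 Q.2 :=
  (hV Q.1 (hL.fst_mem Q hQ) Q.2 (hL.snd_mem Q hQ)
    ⟨Or.inl (hL.fst_mem Q hQ), hQP (fst_mem_interval Q)⟩
    ⟨Or.inr (hL.snd_mem Q hQ), hQP (snd_mem_interval Q)⟩).2 hQ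

/-- Feasibility of `V` at `(x, P.2)` and tightness at `P` bound `V x` by `V P.1 + c x P.2 - c P.1
P.2`; uncrossing absorbs the change of cost. -/
theorem worker_sub_le (hL : IsLayered c X Z Γ) (hP : P ∈ Γ)
    (hV : IsLocalDual c X Z Γ (skillGroup X Z P) V) {x z a : ℝ} (hz : IsOutside z P)
    (h : V P.1 - a ≤ c P.1 z) (hx : x ∈ X) (hxP : x ∈ interval P) : V x - a ≤ c x z := by
  have h1 := hL.uncrossing.worker P x z hxP hz
  have h2 := hV.sub_le hx hxP (hL.snd_mem P hP) (snd_mem_interval P)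
  have h3 := hL.sub_eq hP subset_rfl hV
  linarith

theorem sub_job_le (hL : IsLayered c X Z Γ) (hP : P ∈ Γ)
    (hV : IsLocalDual c X Z Γ (skillGroup X Z P) V) {x z a : ℝ} (hx : IsOutside x P)
    (h : a - V P.2 ≤ c x P.2) (hz : z ∈ Z) (hzP : z ∈ interval P) : a - V z ≤ c x z := by
  have h1 := hL.uncrossing.job P x z hzP hx
  have h2 := hV.sub_le (hL.fst_mem P hP) (fst_mem_interval P) hz hzP
  have h3 := hL.sub_eq hP subset_rfl hV
  linarith

/-- Uncrossing is applied twice: through `P` to pass from its worker to `x`, then through `Q` to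
pass from its job to `z`. -/
theorem sub_le_of_separated (hL : IsLayered c X Z Γ) (hP : P ∈ Γ) (hQ : Q ∈ Γ)
    (hPQ : AreSeparated P Q) (hV : IsLocalDual c X Z Γ (skillGroup X Z P) V)
    (hW : IsLocalDual c X Z Γ (skillGroup X Z Q) W) (h : V P.1 - W Q.2 ≤ c P.1 Q.2) {x z : ℝ}
    (hx : x ∈ X) (hxP : x ∈ interval P) (hz : z ∈ Z) (hzQ : z ∈ interval Q) :
    V x - W z ≤ c x z :=
  hL.sub_job_le hQ hW (hPQ.symm.isOutside hxP)
    (hL.worker_sub_le hP hV (hPQ.isOutside (snd_mem_interval Q)) h hx hxP) hz hzQ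

/-- A shared worker is the worker of both pairs, so the cross constraint at the job of `Q` is
compared with tightness of `W` at `Q`. -/
theorem le_of_separated (hL : IsLayered c X Z Γ) (hP : P ∈ Γ) (hQ : Q ∈ Γ)
    (hPQ : AreSeparated P Q) (hW : IsLocalDual c X Z Γ (skillGroup X Z Q) W) (h : V P.1 - W Q.2 ≤ c P.1 Q.2)
    (hsX : s ∈ X) (hsP : s ∈ interval P) (hsQ : s ∈ interval Q) : V s ≤ W s := by
  obtain rfl := hL.eq_fst hP hsX (hPQ.eq_of_mem hsP hsQ)
  have hPQ1 := hL.eq_fst hQ hsX (hPQ.symm.eq_of_mem hsQ hsP)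
  have h2 := hL.sub_eq hQ subset_rfl hW
  rw [← hPQ1] at h2
  linarith

theorem le_of_separated_of_mem_job (hL : IsLayered c X Z Γ) (hP : P ∈ Γ) (hQ : Q ∈ Γ)
    (hPQ : AreSeparated P Q) (hV : IsLocalDual c X Z Γ (skillGroup X Z P) V)
    (h : V P.1 - W Q.2 ≤ c P.1 Q.2)
    (hsZ : s ∈ Z) (hsP : s ∈ interval P) (hsQ : s ∈ interval Q) : V s ≤ W s := by
  obtain rfl := hL.eq_snd hP hsZ (hPQ.eq_of_mem hsP hsQ)
  have hPQ2 := hL.eq_snd hQ hsZ (hPQ.symm.eq_of_mem hsQ hsP)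
  have h2 := hL.sub_eq hP subset_rfl hV
  rw [← hPQ2] at h
  linarith

theorem eq_of_separated (hL : IsLayered c X Z Γ) (hP : P ∈ Γ) (hQ : Q ∈ Γ)
    (hPQ : AreSeparated P Q) (hV : IsLocalDual c X Z Γ (skillGroup X Z P) V)
    (hW : IsLocalDual c X Z Γ (skillGroup X Z Q) W) (h : V P.1 - W Q.2 ≤ c P.1 Q.2)
    (h' : W Q.1 - V P.2 ≤ c Q.1 P.2) (hsP : s ∈ skillGroup X Z P) (hsQ : s ∈ skillGroup X Z Q) :
    V s = W s := by
  rcases hsP.1 with hX | hZ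
  · exact le_antisymm (hL.le_of_separated hP hQ hPQ hW h hX hsP.2 hsQ.2)
      (hL.le_of_separated hQ hP hPQ.symm hV h' hX hsQ.2 hsP.2)
  · exact le_antisymm (hL.le_of_separated_of_mem_job hP hQ hPQ hV h hZ hsP.2 hsQ.2)
      (hL.le_of_separated_of_mem_job hQ hP hPQ.symm hW h' hZ hsQ.2 hsP.2)

end IsLayered

theorem exists_forall_eq_of_compatible {α β ι : Type*} [Inhabited β] (I : Set ι) (S : ι → Set α)
    (V : ι → α → β) (h : ∀ i ∈ I, ∀ j ∈ I, ∀ s ∈ S i, s ∈ S j → V i s = V j s) :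
    ∃ φ : α → β, ∀ i ∈ I, ∀ s ∈ S i, φ s = V i s := by
  classical
  refine ⟨fun s => if hs : ∃ i ∈ I, s ∈ S i then V hs.choose s else default,
    fun i hi s hsi => ?_⟩
  have hs : ∃ i ∈ I, s ∈ S i := ⟨i, hi, hsi⟩
  simp only [dif_pos hs]
  exact h _ hs.choose_spec.1 i hi s hs.choose_spec.2 hsi

/-! ### Shifts -/

theorem sum_Icc_consecutive {b : ℕ → ℝ} {n m p : ℕ} (hnm : n ≤ m) (hmp : m ≤ p) :
    ∑ k ∈ Finset.Icc (n + 1) m, b k + ∑ k ∈ Finset.Icc (m + 1) p, b k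
      = ∑ k ∈ Finset.Icc (n + 1) p, b k := by
  have h : ∀ a b : ℕ, Finset.Icc (a + 1) b = Finset.Ioc a b := fun a b => by ext; simp
  simp only [h]
  exact Finset.sum_Ioc_consecutive b hnm hmp

theorem sum_Icc_telescope (g : ℕ → ℝ) {n m : ℕ} (hnm : n ≤ m) :
    ∑ k ∈ Finset.Icc (n + 1) m, (g (k - 1) - g k) = g n - g m := by
  induction m, hnm using Nat.le_induction with
  | base => simp
  | succ m hm ih =>
    rw [Finset.sum_Icc_succ_top (by omega), ih]
    simp

/-- The potential of the `i`-th pair of the family `N`, shifted by a constant. -/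
noncomputable def shiftedPotential (N : ℕ → Pair) (p : ℕ) (b : ℕ → ℝ) (Φ : Pair → ℝ → ℝ) (i : ℕ) (s : ℝ) : ℝ :=
  Φ (N i) s + ∑ k ∈ Finset.Icc (i + 1) p, b k + Φ (N p) (N p).1 - Φ (N i) (N i).1

/-- Each local potential is normalized at its own worker, so sums of shifts are exactly wage
differences between the workers of the family. -/
theorem shiftedPotential_sub (N : ℕ → Pair) (p : ℕ) (b : ℕ → ℝ) (Φ : Pair → ℝ → ℝ) {n m : ℕ}
    (hnm : n ≤ m) (hmp : m ≤ p) :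
    shiftedPotential N p b Φ n (N n).1 - shiftedPotential N p b Φ m (N m).1
      = ∑ k ∈ Finset.Icc (n + 1) m, b k := by
  rw [shiftedPotential, shiftedPotential, ← sum_Icc_consecutive hnm hmp]
  ring

/-- The bounds on the shifts that come from exchanges between the pairs of a family. -/
def IsFamilyShift (c : ℝ → ℝ → ℝ) (N : ℕ → Pair) (p : ℕ) (b : ℕ → ℝ) : Prop :=
  ∀ n m : ℕ, 1 ≤ n → n < m → m ≤ p →
    -c (N m).1 (N n).2 + c (N n).1 (N n).2 ≤ ∑ k ∈ Finset.Icc (n + 1) m, b k ∧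
      ∑ k ∈ Finset.Icc (n + 1) m, b k ≤ c (N n).1 (N m).2 - c (N m).1 (N m).2

theorem IsShift.isFamilyShift {c : ℝ → ℝ → ℝ} {Γ : Finset Pair} {P : Pair} {b : ℕ → ℝ}
    (hb : IsShift c Γ P b) : IsFamilyShift c (node Γ P) (numSub Γ P) b := fun n m hn hnm hm =>
  ⟨(add_le_add_left (le_max_right _ _) _).trans (hb n m hn hnm hm).1,
    (hb n m hn hnm hm).2.trans (sub_le_sub_right (min_le_right _ _) _)⟩

section Family

variable {c : ℝ → ℝ → ℝ} {X Z : Finset ℝ} {Γ : Finset Pair} {N : ℕ → Pair} {p : ℕ} {b : ℕ → ℝ}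
  {Φ : Pair → ℝ → ℝ}

theorem IsLocalDual.shiftedPotential {A : Set ℝ} {i : ℕ}
    (hΦ : IsLocalDual c X Z Γ A (Φ (N i))) :
    IsLocalDual c X Z Γ A (shiftedPotential N p b Φ i) :=
  hΦ.of_eqOn_add (∑ k ∈ Finset.Icc (i + 1) p, b k + Φ (N p) (N p).1 - Φ (N i) (N i).1)
    fun s => by rw [_root_.shiftedPotential]; ring

/-- Tightness at the `j`-th pair converts a bound on the difference of two workers' wages into a
worker-job constraint; the upper bounds serve `i < j`, the lower ones `j < i`. -/
theorem IsFamilyShift.sub_le (hb : IsFamilyShift c N p b) (hL : IsLayered c X Z Γ)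
    (hN : IsSeparatedFamily Γ N p)
    (hΦ : ∀ i ∈ Finset.Icc 1 p, IsLocalDual c X Z Γ (skillGroup X Z (N i)) (Φ (N i)))
    {i j : ℕ} (hi : i ∈ Finset.Icc 1 p) (hj : j ∈ Finset.Icc 1 p) :
    shiftedPotential N p b Φ i (N i).1 - shiftedPotential N p b Φ j (N j).2
      ≤ c (N i).1 (N j).2 := by
  have hj1 := hL.sub_eq (hN.mem j hj) subset_rfl ((hΦ j hj).shiftedPotential (p := p) (b := b))
  rcases lt_trichotomy i j with h | rfl | h
  · rw [Finset.mem_Icc] at hi hj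
    have h1 := (hb i j hi.1 h hj.2).2
    rw [← shiftedPotential_sub N p b Φ h.le hj.2] at h1
    linarith
  · exact hj1.le
  · rw [Finset.mem_Icc] at hi hj
    have h1 := (hb j i hj.1 h hi.2).1
    rw [← shiftedPotential_sub N p b Φ h.le hi.2] at h1
    linarith

theorem IsFamilyShift.sub_le_of_mem (hb : IsFamilyShift c N p b) (hL : IsLayered c X Z Γ)
    (hN : IsSeparatedFamily Γ N p)
    (hΦ : ∀ i ∈ Finset.Icc 1 p, IsLocalDual c X Z Γ (skillGroup X Z (N i)) (Φ (N i)))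
    {i j : ℕ} (hi : i ∈ Finset.Icc 1 p) (hj : j ∈ Finset.Icc 1 p) {x z : ℝ} (hx : x ∈ X)
    (hxi : x ∈ interval (N i)) (hz : z ∈ Z) (hzj : z ∈ interval (N j)) :
    shiftedPotential N p b Φ i x - shiftedPotential N p b Φ j z ≤ c x z := by
  by_cases hij : i = j
  · subst hij
    exact (hΦ i hi).shiftedPotential.sub_le hx hxi hz hzj
  · exact hL.sub_le_of_separated (hN.mem i hi) (hN.mem j hj) (hN.separated i hi j hj hij)
      (hΦ i hi).shiftedPotential (hΦ j hj).shiftedPotential (hb.sub_le hL hN hΦ hi hj)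
      hx hxi hz hzj

theorem IsFamilyShift.exists_glued (hb : IsFamilyShift c N p b) (hL : IsLayered c X Z Γ)
    (hN : IsSeparatedFamily Γ N p)
    (hΦ : ∀ i ∈ Finset.Icc 1 p, IsLocalDual c X Z Γ (skillGroup X Z (N i)) (Φ (N i))) :
    ∃ φ : ℝ → ℝ, ∀ i ∈ Finset.Icc 1 p, ∀ s ∈ skillGroup X Z (N i),
      φ s = shiftedPotential N p b Φ i s := by
  refine exists_forall_eq_of_compatible (Finset.Icc 1 p : Set ℕ) (fun i => skillGroup X Z (N i))
    (_root_.shiftedPotential N p b Φ) fun i hi j hj s hsi hsj => ?_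
  by_cases hij : i = j
  · rw [hij]
  · exact hL.eq_of_separated (hN.mem i hi) (hN.mem j hj) (hN.separated i hi j hj hij)
      (hΦ i hi).shiftedPotential (hΦ j hj).shiftedPotential (hb.sub_le hL hN hΦ hi hj)
      (hb.sub_le hL hN hΦ hj hi) hsi hsj

end Family

/-! ### One step of the mechanism -/

section Step

variable {c : ℝ → ℝ → ℝ} {X Z : Finset ℝ} {Γ : Finset Pair} {P : Pair} {b : ℕ → ℝ}
  {Φ : Pair → ℝ → ℝ} {φ φ' : ℝ → ℝ}

/-- Each lower bound on the value at the job of `P` lies below each upper bound. For `i ≠ j` this is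
an index-0 term of the shift system; for `i = j` it is the swap inequality between the subpair and
`P`. -/
theorem IsShift.worker_le_job (hb : IsShift c Γ P b) (hL : IsLayered c X Z Γ) (hP : P ∈ Γ)
    (hΦ : ∀ Q ∈ subpairs Γ P, IsLocalDual c X Z Γ (skillGroup X Z Q) (Φ Q)) {i j : ℕ}
    (hi : i ∈ Finset.Icc 1 (numSub Γ P)) (hj : j ∈ Finset.Icc 1 (numSub Γ P)) :
    shiftedPotential (node Γ P) (numSub Γ P) b Φ i (node Γ P i).1 - c (node Γ P i).1 P.2
      ≤ shiftedPotential (node Γ P) (numSub Γ P) b Φ j (node Γ P j).2 + c P.1 (node Γ P j).2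
        - c P.1 P.2 := by
  have hN := hL.isSeparatedFamily_node P
  have hj1 := hL.sub_eq (hN.mem j hj) subset_rfl
    ((hΦ _ (node_mem hj)).shiftedPotential (p := numSub Γ P) (b := b))
  rcases lt_trichotomy i j with h | rfl | h
  · rw [Finset.mem_Icc] at hi hj
    have h1 := (hb i j hi.1 h hj.2).2.trans (sub_le_sub_right (min_le_left _ _) _)
    rw [← shiftedPotential_sub (node Γ P) (numSub Γ P) b Φ h.le hj.2] at h1
    simp only [node_zero] at h1
    linarith
  · have := hL.swap_le (hN.mem i hi) hP
    linarith
  · rw [Finset.mem_Icc] at hi hj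
    have h1 := (add_le_add_left (le_max_left _ _) _).trans (hb j i hj.1 h hi.2).1
    rw [← shiftedPotential_sub (node Γ P) (numSub Γ P) b Φ h.le hi.2] at h1
    simp only [node_zero] at h1
    linarith

/-- The value `a` at the job of `P` is compatible with the shifted potentials of the subpairs. -/
def IsAdmissible (c : ℝ → ℝ → ℝ) (Γ : Finset Pair) (P : Pair) (b : ℕ → ℝ) (Φ : Pair → ℝ → ℝ)
    (a : ℝ) : Prop :=
  ∀ i ∈ Finset.Icc 1 (numSub Γ P),
    shiftedPotential (node Γ P) (numSub Γ P) b Φ i (node Γ P i).1 - a ≤ c (node Γ P i).1 P.2 ∧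
    a + c P.1 P.2 - shiftedPotential (node Γ P) (numSub Γ P) b Φ i (node Γ P i).2
      ≤ c P.1 (node Γ P i).2

theorem IsShift.isAdmissible_sup (hb : IsShift c Γ P b) (hL : IsLayered c X Z Γ) (hP : P ∈ Γ)
    (hΦ : ∀ Q ∈ subpairs Γ P, IsLocalDual c X Z Γ (skillGroup X Z Q) (Φ Q))
    (hp : 1 ≤ numSub Γ P) :
    IsAdmissible c Γ P b Φ ((Finset.Icc 1 (numSub Γ P)).sup' (Finset.nonempty_Icc.2 hp)
      fun i => shiftedPotential (node Γ P) (numSub Γ P) b Φ i (node Γ P i).1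
        - c (node Γ P i).1 P.2) := by
  refine fun i hi => ⟨?_, ?_⟩
  · have := Finset.le_sup' (fun i => shiftedPotential (node Γ P) (numSub Γ P) b Φ i (node Γ P i).1
        - c (node Γ P i).1 P.2) hi
    linarith
  · have := Finset.sup'_le (Finset.nonempty_Icc.2 hp) _ fun j hj =>
      hb.worker_le_job hL hP hΦ hj hi
    linarith

theorem IsShift.isAdmissible_inf (hb : IsShift c Γ P b) (hL : IsLayered c X Z Γ) (hP : P ∈ Γ)
    (hΦ : ∀ Q ∈ subpairs Γ P, IsLocalDual c X Z Γ (skillGroup X Z Q) (Φ Q))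
    (hp : 1 ≤ numSub Γ P) :
    IsAdmissible c Γ P b Φ ((Finset.Icc 1 (numSub Γ P)).inf' (Finset.nonempty_Icc.2 hp)
      (fun i => shiftedPotential (node Γ P) (numSub Γ P) b Φ i (node Γ P i).2
        + c P.1 (node Γ P i).2) - c P.1 P.2) := by
  refine fun i hi => ⟨?_, ?_⟩
  · have := Finset.le_inf' (Finset.nonempty_Icc.2 hp)
      (fun i => shiftedPotential (node Γ P) (numSub Γ P) b Φ i (node Γ P i).2
        + c P.1 (node Γ P i).2) (a := shiftedPotential (node Γ P) (numSub Γ P) b Φ i (node Γ P i).1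
        - c (node Γ P i).1 P.2 + c P.1 P.2) fun j hj => by
          linarith [hb.worker_le_job hL hP hΦ hi hj]
    linarith
  · have := Finset.inf'_le (fun i => shiftedPotential (node Γ P) (numSub Γ P) b Φ i (node Γ P i).2
        + c P.1 (node Γ P i).2) hi
    linarith

/-- The conditions on a pair potential, with the values at the subpairs made explicit. -/
theorem isPairPotential_iff (hL : IsLayered c X Z Γ) (hp : 1 ≤ numSub Γ P) :
    IsPairPotential c X Z Γ P b Φ φ ↔
      (∀ i ∈ Finset.Icc 1 (numSub Γ P), ∀ s ∈ skillGroup X Z (node Γ P i),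
        φ s = shiftedPotential (node Γ P) (numSub Γ P) b Φ i s) ∧
      φ P.2 = (if (node Γ P 1).1 ≠ P.1 then
        (Finset.Icc 1 (numSub Γ P)).sup' (Finset.nonempty_Icc.2 hp)
          fun i => shiftedPotential (node Γ P) (numSub Γ P) b Φ i (node Γ P i).1
            - c (node Γ P i).1 P.2
        else (Finset.Icc 1 (numSub Γ P)).inf' (Finset.nonempty_Icc.2 hp)
          (fun i => shiftedPotential (node Γ P) (numSub Γ P) b Φ i (node Γ P i).2
            + c P.1 (node Γ P i).2) - c P.1 P.2) ∧
      φ P.1 = φ P.2 + c P.1 P.2 := by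
  have hN := hL.isSeparatedFamily_node P
  have hsup : (∀ i ∈ Finset.Icc 1 (numSub Γ P), ∀ s ∈ skillGroup X Z (node Γ P i),
        φ s = shiftedPotential (node Γ P) (numSub Γ P) b Φ i s) →
      (Finset.Icc 1 (numSub Γ P)).sup' (Finset.nonempty_Icc.2 hp)
        (fun i => φ (node Γ P i).1 - c (node Γ P i).1 P.2) =
      (Finset.Icc 1 (numSub Γ P)).sup' (Finset.nonempty_Icc.2 hp)
          fun i => shiftedPotential (node Γ P) (numSub Γ P) b Φ i (node Γ P i).1
            - c (node Γ P i).1 P.2 := fun h =>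
    Finset.sup'_congr _ rfl fun i hi => by rw [h i hi _ (hL.fst_mem_skillGroup (hN.mem i hi))]
  have hinf : (∀ i ∈ Finset.Icc 1 (numSub Γ P), ∀ s ∈ skillGroup X Z (node Γ P i),
        φ s = shiftedPotential (node Γ P) (numSub Γ P) b Φ i s) →
      (Finset.Icc 1 (numSub Γ P)).inf' (Finset.nonempty_Icc.2 hp)
        (fun i => φ (node Γ P i).2 + c P.1 (node Γ P i).2) =
      (Finset.Icc 1 (numSub Γ P)).inf' (Finset.nonempty_Icc.2 hp)
          fun i => shiftedPotential (node Γ P) (numSub Γ P) b Φ i (node Γ P i).2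
            + c P.1 (node Γ P i).2 := fun h =>
    Finset.inf'_congr _ rfl fun i hi => by rw [h i hi _ (hL.snd_mem_skillGroup (hN.mem i hi))]
  constructor
  · intro h
    refine ⟨h.shift, ?_, h.worker hp⟩
    split_ifs with h1
    · rw [h.job_max hp h1, hsup h.shift]
    · rw [h.job_min hp (not_not.1 h1), hinf h.shift]
  · rintro ⟨h1, h2, h3⟩
    refine ⟨fun h0 => absurd h0 (by omega), h1, fun _ hne => ?_, fun _ heq => ?_, fun _ => h3⟩
    · rw [h2, if_pos hne, hsup h1]
    · rw [h2, if_neg (not_not.2 heq), hinf h1]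

/-- The two branches are the two ends of the interval of admissible values. Consistency and dual
feasibility need only admissibility, not the rule that selects the end. -/
theorem IsShift.isAdmissible_ite (hb : IsShift c Γ P b) (hL : IsLayered c X Z Γ) (hP : P ∈ Γ)
    (hΦ : ∀ Q ∈ subpairs Γ P, IsLocalDual c X Z Γ (skillGroup X Z Q) (Φ Q))
    (hp : 1 ≤ numSub Γ P) :
    IsAdmissible c Γ P b Φ (if (node Γ P 1).1 ≠ P.1 then
        (Finset.Icc 1 (numSub Γ P)).sup' (Finset.nonempty_Icc.2 hp)
          fun i => shiftedPotential (node Γ P) (numSub Γ P) b Φ i (node Γ P i).1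
            - c (node Γ P i).1 P.2
        else (Finset.Icc 1 (numSub Γ P)).inf' (Finset.nonempty_Icc.2 hp)
          (fun i => shiftedPotential (node Γ P) (numSub Γ P) b Φ i (node Γ P i).2
            + c P.1 (node Γ P i).2) - c P.1 P.2) := by
  split_ifs
  · exact hb.isAdmissible_sup hL hP hΦ hp
  · exact hb.isAdmissible_inf hL hP hΦ hp

theorem subpairs_eq_empty (hp : ¬ 1 ≤ numSub Γ P) : subpairs Γ P = ∅ :=
  Finset.card_eq_zero.1 (by rw [numSub] at hp; omega)

theorem IsLayered.exists_isPairPotential (hL : IsLayered c X Z Γ) (hP : P ∈ Γ)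
    (hΦ : ∀ Q ∈ subpairs Γ P, IsLocalDual c X Z Γ (skillGroup X Z Q) (Φ Q))
    (hb : IsShift c Γ P b) : ∃ φ, IsPairPotential c X Z Γ P b Φ φ := by
  have hne : P.1 ≠ P.2 := hL.fst_ne_snd hP hP
  by_cases hp : 1 ≤ numSub Γ P
  swap
  · refine ⟨fun s => if s = P.1 then c P.1 P.2 else 0, fun _ => ⟨if_neg hne.symm, if_pos rfl⟩,
      fun i hi => ?_, fun h => absurd h hp, fun h => absurd h hp, fun h => absurd h hp⟩
    rw [Finset.mem_Icc] at hi
    omega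
  have hN := hL.isSeparatedFamily_node P
  have hΦ' := fun i (hi : i ∈ Finset.Icc 1 (numSub Γ P)) => hΦ _ (node_mem hi)
  obtain ⟨φ, hφ⟩ := hb.isFamilyShift.exists_glued hL hN hΦ'
  have hadm := hb.isAdmissible_ite hL hP hΦ hp
  simp only [isPairPotential_iff hL hp]
  set a : ℝ := if (node Γ P 1).1 ≠ P.1 then
        (Finset.Icc 1 (numSub Γ P)).sup' (Finset.nonempty_Icc.2 hp)
          fun i => shiftedPotential (node Γ P) (numSub Γ P) b Φ i (node Γ P i).1
            - c (node Γ P i).1 P.2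
        else (Finset.Icc 1 (numSub Γ P)).inf' (Finset.nonempty_Icc.2 hp)
          (fun i => shiftedPotential (node Γ P) (numSub Γ P) b Φ i (node Γ P i).2
            + c P.1 (node Γ P i).2) - c P.1 P.2 with ha
  clear_value a
  -- The glued potential is overridden at the members of `P`. A clash is possible only if a subpair
  -- shares a member with `P`; then its two admissibility inequalities and its tightness force the
  -- same value.
  refine ⟨fun s => if s = P.1 then a + c P.1 P.2 else if s = P.2 then a else φ s,
    fun i hi s hs => ?_, by simp [hne.symm], by simp [hne.symm]⟩
  have hi1 := hL.sub_eq (hN.mem i hi) subset_rfl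
    ((hΦ' i hi).shiftedPotential (p := numSub Γ P) (b := b))
  have hi2 := hadm i hi
  have hsub := interval_subset_of_mem_subpairs (node_mem hi)
  dsimp only
  split_ifs with h1 h2
  · subst h1
    have := hL.eq_fst (hN.mem i hi) (hL.fst_mem P hP)
      ((isOutside_of_interval_subset hsub (Or.inl rfl)).eq_of_mem hs.2)
    rw [this] at hi2 ⊢
    linarith
  · subst h2
    have := hL.eq_snd (hN.mem i hi) (hL.snd_mem P hP)
      ((isOutside_of_interval_subset hsub (Or.inr rfl)).eq_of_mem hs.2)
    rw [this] at hi2 ⊢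
    linarith
  · exact hφ i hi s hs

theorem IsPairPotential.isLocalDual (hφ : IsPairPotential c X Z Γ P b Φ φ)
    (hL : IsLayered c X Z Γ) (hP : P ∈ Γ)
    (hΦ : ∀ Q ∈ subpairs Γ P, IsLocalDual c X Z Γ (skillGroup X Z Q) (Φ Q))
    (hb : IsShift c Γ P b) : IsLocalDual c X Z Γ (skillGroup X Z P) φ := by
  have hcover : ∀ s ∈ skillGroup X Z P, s = P.1 ∨ s = P.2 ∨
      ∃ i ∈ Finset.Icc 1 (numSub Γ P), s ∈ skillGroup X Z (node Γ P i) := by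
    intro s hs
    rcases hL.eq_or_mem_subpair hP hs with h | h | ⟨Q, hQ, hsQ⟩
    · exact Or.inl h
    · exact Or.inr (Or.inl h)
    · obtain ⟨i, hi, rfl⟩ := exists_node_eq hQ
      exact Or.inr (Or.inr ⟨i, hi, hsQ⟩)
  have hN := hL.isSeparatedFamily_node P
  have hΦ' := fun i (hi : i ∈ Finset.Icc 1 (numSub Γ P)) => hΦ _ (node_mem hi)
  have hP12 : φ P.1 = φ P.2 + c P.1 P.2 := by
    by_cases hp : 1 ≤ numSub Γ P
    · exact hφ.worker hp
    · obtain ⟨h1, h2⟩ := hφ.leaf (by omega)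
      rw [h1, h2, zero_add]
  have hadm : IsAdmissible c Γ P b Φ (φ P.2) := by
    by_cases hp : 1 ≤ numSub Γ P
    · rw [((isPairPotential_iff hL hp).1 hφ).2.1]
      exact hb.isAdmissible_ite hL hP hΦ hp
    · intro i hi
      rw [Finset.mem_Icc] at hi
      omega
  have hshift : ∀ i ∈ Finset.Icc 1 (numSub Γ P), ∀ s ∈ skillGroup X Z (node Γ P i),
      φ s = shiftedPotential (node Γ P) (numSub Γ P) b Φ i s := hφ.shift
  have hsub := fun i (hi : i ∈ Finset.Icc 1 (numSub Γ P)) =>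
    interval_subset_of_mem_subpairs (node_mem hi)
  intro x hx z hz hxP hzP
  constructor
  · have hx' : x = P.1 ∨ ∃ i ∈ Finset.Icc 1 (numSub Γ P), x ∈ skillGroup X Z (node Γ P i) := by
      rcases hcover x hxP with h | h | h
      exacts [Or.inl h, Or.inl (hL.eq_fst hP hx (Or.inr h)), Or.inr h]
    have hz' : z = P.2 ∨ ∃ i ∈ Finset.Icc 1 (numSub Γ P), z ∈ skillGroup X Z (node Γ P i) := by
      rcases hcover z hzP with h | h | h
      exacts [Or.inl (hL.eq_snd hP hz (Or.inl h)), Or.inl h, Or.inr h]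
    -- Constraints involving one member of `P` follow from admissibility by uncrossing through the
    -- subpair of the other party, since members of `P` lie outside the interior of every subpair.
    rcases hx' with rfl | ⟨i, hi, hxi⟩ <;> rcases hz' with rfl | ⟨j, hj, hzj⟩
    · linarith
    · rw [hshift j hj z hzj, hP12]
      exact hL.sub_job_le (hN.mem j hj) (hΦ' j hj).shiftedPotential
        (isOutside_of_interval_subset (hsub j hj) (Or.inl rfl)) (hadm j hj).2 hz hzj.2
    · rw [hshift i hi x hxi]
      exact hL.worker_sub_le (hN.mem i hi) (hΦ' i hi).shiftedPotential
        (isOutside_of_interval_subset (hsub i hi) (Or.inr rfl)) (hadm i hi).1 hx hxi.2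
    · rw [hshift i hi x hxi, hshift j hj z hzj]
      exact hb.isFamilyShift.sub_le_of_mem hL hN hΦ' hi hj hx hxi.2 hz hzj.2
  · intro hxz
    by_cases hne : ((x, z) : Pair) = P
    · subst hne
      exact sub_eq_of_eq_add' hP12
    · obtain ⟨Q, hQ, hsubQ⟩ := hL.exists_mem_subpairs
        (mem_pairsWithin.2 ⟨hxz, Set.uIcc_subset_uIcc hxP.2 hzP.2⟩) hne
      obtain ⟨i, hi, rfl⟩ := exists_node_eq hQ
      have hxi := hsubQ (fst_mem_interval (x, z))
      have hzi := hsubQ (snd_mem_interval (x, z))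
      rw [hshift i hi x ⟨Or.inl hx, hxi⟩, hshift i hi z ⟨Or.inr hz, hzi⟩]
      exact hL.sub_eq hxz hsubQ (hΦ' i hi).shiftedPotential

/-- The pair potential is determined by the shifts and by the potentials of the subpairs on
their groups. -/
theorem IsPairPotential.eqOn {b' : ℕ → ℝ} {Φ' : Pair → ℝ → ℝ}
    (hφ : IsPairPotential c X Z Γ P b Φ φ)
    (hφ' : IsPairPotential c X Z Γ P b' Φ' φ') (hL : IsLayered c X Z Γ) (hP : P ∈ Γ)
    (hb : ∀ k ∈ Finset.Icc 2 (numSub Γ P), b k = b' k)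
    (hΦ : ∀ Q ∈ subpairs Γ P, Set.EqOn (Φ Q) (Φ' Q) (skillGroup X Z Q)) :
    Set.EqOn φ φ' (skillGroup X Z P) := by
  have hN := hL.isSeparatedFamily_node P
  by_cases hp : 1 ≤ numSub Γ P
  · have hV : ∀ i ∈ Finset.Icc 1 (numSub Γ P), ∀ s ∈ skillGroup X Z (node Γ P i),
        shiftedPotential (node Γ P) (numSub Γ P) b Φ i s
          = shiftedPotential (node Γ P) (numSub Γ P) b' Φ' i s := by
      intro i hi s hs
      have hp' : numSub Γ P ∈ Finset.Icc 1 (numSub Γ P) := Finset.right_mem_Icc.2 hp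
      have hsum : ∑ k ∈ Finset.Icc (i + 1) (numSub Γ P), b k
          = ∑ k ∈ Finset.Icc (i + 1) (numSub Γ P), b' k := by
        refine Finset.sum_congr rfl fun k hk => hb k ?_
        rw [Finset.mem_Icc] at hi hk ⊢
        omega
      rw [shiftedPotential, shiftedPotential, hsum, hΦ _ (node_mem hi) hs,
        hΦ _ (node_mem hi) (hL.fst_mem_skillGroup (hN.mem i hi)),
        hΦ _ (node_mem hp') (hL.fst_mem_skillGroup (hN.mem _ hp'))]
    obtain ⟨h1, h2, h3⟩ := (isPairPotential_iff hL hp).1 hφ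
    obtain ⟨h1', h2', h3'⟩ := (isPairPotential_iff hL hp).1 hφ'
    have h22 : φ P.2 = φ' P.2 := by
      rw [h2, h2']
      congr 1
      · exact Finset.sup'_congr _ rfl fun i hi => by
          rw [hV i hi _ (hL.fst_mem_skillGroup (hN.mem i hi))]
      · rw [Finset.inf'_congr _ rfl fun i hi => by
          rw [hV i hi _ (hL.snd_mem_skillGroup (hN.mem i hi))]]
    intro s hs
    rcases hL.eq_or_mem_subpair hP hs with rfl | rfl | ⟨Q, hQ, hsQ⟩
    · rw [h3, h3', h22]
    · exact h22
    · obtain ⟨i, hi, rfl⟩ := exists_node_eq hQ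
      rw [h1 i hi s hsQ, h1' i hi s hsQ, hV i hi s hsQ]
  · intro s hs
    obtain ⟨h1, h2⟩ := hφ.leaf (by omega)
    obtain ⟨h1', h2'⟩ := hφ'.leaf (by omega)
    rcases hL.eq_or_mem_subpair hP hs with rfl | rfl | ⟨Q, hQ, -⟩
    · rw [h2, h2']
    · rw [h1, h1']
    · simp [subpairs_eq_empty hp] at hQ

end Step

/-! ### Solutions of the shift systems -/

/-- A nonempty compact set of sequences contains one whose first `n` terms are smallest in
dictionary order. -/
theorem IsCompact.exists_lex_min {K : Set (ℕ → ℝ)} (hK : IsCompact K) (hne : K.Nonempty) (n : ℕ) :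
    ∃ b ∈ K, ∀ b' ∈ K,
      (∀ k < n, b k = b' k) ∨ ∃ k < n, (∀ j < k, b j = b' j) ∧ b k < b' k := by
  induction n with
  | zero => exact hne.imp fun b hb => ⟨hb, fun b' _ => Or.inl (by simp)⟩
  | succ n ih =>
    obtain ⟨b₀, hb₀, hmin⟩ := ih
    -- Among the sequences agreeing with the previous minimizer in the first `n` terms, term `n` is
    -- minimized.
    have hK' : IsCompact (K ∩ ⋂ k, ⋂ _ : k < n, {b | b₀ k = b k}) :=
      hK.inter_right (isClosed_iInter fun k => isClosed_iInter fun _ =>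
        isClosed_eq continuous_const (continuous_apply k))
    obtain ⟨b, ⟨hbK, hb⟩, hle⟩ := hK'.exists_isMinOn ⟨b₀, hb₀, by simp⟩
      (continuous_apply n).continuousOn
    replace hb : ∀ k < n, b₀ k = b k := by simpa using hb
    refine ⟨b, hbK, fun b' hb' => ?_⟩
    rcases hmin b' hb' with h | ⟨k, hk, hj, hlt⟩
    · rcases (isMinOn_iff.1 hle b' ⟨hb', by simpa using h⟩).eq_or_lt with heq | hlt
      · refine Or.inl fun k hk => ?_
        rcases Nat.lt_succ_iff_lt_or_eq.1 hk with hk | rfl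
        · rw [← hb k hk, h k hk]
        · exact heq
      · exact Or.inr ⟨n, n.lt_succ_self, fun j hj => by rw [← hb j hj, h j hj], hlt⟩
    · exact Or.inr ⟨k, by omega, fun j hjk => by rw [← hb j (by omega), hj j hjk],
        by rwa [← hb k hk]⟩

section Shift

variable {c : ℝ → ℝ → ℝ} {X Z : Finset ℝ} {Γ : Finset Pair} {P : Pair} {b b' : ℕ → ℝ}

/-- Differences of consecutive dual wages telescope to `u n - u m`. The index-0 bounds come from
passing through `P`: two cross constraints with `P` combined with tightness at `P`. -/
theorem IsLayered.exists_isShift (hL : IsLayered c X Z Γ) (hP : P ∈ Γ) :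
    ∃ b, IsShift c Γ P b := by
  obtain ⟨u, v, huv, hle⟩ := hL.exists_dual
  have hN := (hL.isSeparatedFamily_node P).mem
  refine ⟨fun k => u (node Γ P (k - 1)) - u (node Γ P k), fun n m hn hnm hm => ?_⟩
  rw [sum_Icc_telescope (fun k => u (node Γ P k)) hnm.le]
  simp only [node_zero]
  have hn' := hN n (Finset.mem_Icc.2 ⟨hn, by omega⟩)
  have hm' := hN m (Finset.mem_Icc.2 ⟨by omega, hm⟩)
  have e1 := huv _ hn'
  have e2 := huv _ hm'
  have e3 := huv _ hP
  have i1 := hle _ hn' _ hm'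
  have i2 := hle _ hm' _ hn'
  have i3 := hle _ hP _ hm'
  have i4 := hle _ hP _ hn'
  have i5 := hle _ hn' _ hP
  have i6 := hle _ hm' _ hP
  constructor
  · rw [← le_sub_iff_add_le]
    exact max_le (by linarith) (by linarith)
  · rw [le_sub_iff_add_le]
    exact le_min (by linarith) (by linarith)

theorem IsLayered.exists_isOuterShift (hL : IsLayered c X Z Γ) : ∃ γ, IsOuterShift c Γ γ := by
  obtain ⟨u, v, huv, hle⟩ := hL.exists_dual
  have hN := hL.isSeparatedFamily_outer.mem
  refine ⟨fun k => u (outer Γ (k - 1)) - u (outer Γ k), fun n m hn hnm hm => ?_⟩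
  rw [sum_Icc_telescope (fun k => u (outer Γ k)) hnm.le]
  have hn' := hN n (Finset.mem_Icc.2 ⟨hn, by omega⟩)
  have hm' := hN m (Finset.mem_Icc.2 ⟨by omega, hm⟩)
  have e1 := huv _ hn'
  have e2 := huv _ hm'
  have i1 := hle _ hn' _ hm'
  have i2 := hle _ hm' _ hn'
  constructor <;> linarith

theorem IsShift.congr (hb : IsShift c Γ P b) (h : ∀ k ∈ Finset.Icc 2 (numSub Γ P), b k = b' k) :
    IsShift c Γ P b' := by
  intro n m hn hnm hm
  have hsum : ∑ k ∈ Finset.Icc (n + 1) m, b' k = ∑ k ∈ Finset.Icc (n + 1) m, b k := by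
    refine Finset.sum_congr rfl fun k hk => (h k ?_).symm
    rw [Finset.mem_Icc] at hk ⊢
    omega
  rw [hsum]
  exact hb n m hn hnm hm

theorem isClosed_setOf_isShift (c : ℝ → ℝ → ℝ) (Γ : Finset Pair) (P : Pair) :
    IsClosed {b | IsShift c Γ P b} := by
  simp only [IsShift, Set.ofPred_forall]
  refine isClosed_iInter fun n => isClosed_iInter fun m => isClosed_iInter fun _ =>
    isClosed_iInter fun _ => isClosed_iInter fun _ => ?_
  have hcont : Continuous fun b : ℕ → ℝ => ∑ k ∈ Finset.Icc (n + 1) m, b k :=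
    continuous_finsetSum _ fun k _ => continuous_apply k
  exact (isClosed_le continuous_const hcont).inter (isClosed_le hcont continuous_const)

/-- Only `β 2, …, β p` enter the system, so the others are frozen at zero; the constraints for
consecutive indices `k - 1`, `k` bound each remaining coordinate on both sides. -/
theorem isCompact_setOf_isShift (c : ℝ → ℝ → ℝ) (Γ : Finset Pair) (P : Pair) :
    IsCompact {b | IsShift c Γ P b ∧ ∀ k ∉ Finset.Icc 2 (numSub Γ P), b k = 0} := by
  let C : ℕ → ℕ → ℝ := fun i j => c (node Γ P i).1 (node Γ P j).2
  let l : ℕ → ℝ := fun k => if k ∈ Finset.Icc 2 (numSub Γ P) then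
    -C k (k - 1) + C (k - 1) (k - 1) else 0
  let r : ℕ → ℝ := fun k => if k ∈ Finset.Icc 2 (numSub Γ P) then C (k - 1) k - C k k else 0
  refine (isCompact_univ_pi fun k => isCompact_Icc (a := l k) (b := r k)).of_isClosed_subset ?_ ?_
  · refine (isClosed_setOf_isShift c Γ P).inter
      (s₂ := {b | ∀ k ∉ Finset.Icc 2 (numSub Γ P), b k = 0}) ?_
    simp only [Set.ofPred_forall]
    exact isClosed_iInter fun k => isClosed_iInter fun _ =>
      isClosed_eq (continuous_apply k) continuous_const
  · rintro b ⟨hb, hb0⟩ k -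
    by_cases hk : k ∈ Finset.Icc 2 (numSub Γ P)
    · have hk' := Finset.mem_Icc.1 hk
      have := hb.isFamilyShift (k - 1) k (by omega) (by omega) hk'.2
      rw [Nat.sub_add_cancel (by omega), Finset.Icc_self, Finset.sum_singleton] at this
      simpa only [l, r, C, if_pos hk, Set.mem_Icc] using this
    · simp only [l, r, if_neg hk, hb0 k hk, Set.mem_Icc, le_refl, and_self]

theorem IsLayered.exists_isDefaultShift (hL : IsLayered c X Z Γ) (hP : P ∈ Γ) :
    ∃ b, IsDefaultShift c Γ P b := by
  classical
  have htrunc : ∀ b, IsShift c Γ P b →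
      (fun k => if k ∈ Finset.Icc 2 (numSub Γ P) then b k else 0) ∈
        {b | IsShift c Γ P b ∧ ∀ k ∉ Finset.Icc 2 (numSub Γ P), b k = 0} := fun b hb =>
    ⟨hb.congr fun k hk => (if_pos hk).symm, fun k hk => if_neg hk⟩
  obtain ⟨b₀, hb₀⟩ := hL.exists_isShift hP
  obtain ⟨b, hb, hmin⟩ := (isCompact_setOf_isShift c Γ P).exists_lex_min
    ⟨_, htrunc b₀ hb₀⟩ (numSub Γ P + 1)
  refine ⟨b, hb.1, fun b' hb' => ?_⟩
  rcases hmin _ (htrunc b' hb') with h | ⟨k, -, hj, hlt⟩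
  · refine Or.inl fun k hk => ?_
    rw [h k (by rw [Finset.mem_Icc] at hk; omega), if_pos hk]
  · have hk : k ∈ Finset.Icc 2 (numSub Γ P) := by
      by_contra hk
      rw [if_neg hk, hb.2 k hk] at hlt
      exact lt_irrefl _ hlt
    refine Or.inr ⟨k, hk, fun j hj' hjk => ?_, by rwa [if_pos hk] at hlt⟩
    rw [hj j hjk, if_pos hj']

theorem ShiftLexLE.eq_of_symm {p : ℕ} (h : ShiftLexLE p b b') (h' : ShiftLexLE p b' b) :
    ∀ k ∈ Finset.Icc 2 p, b k = b' k := by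
  rcases h with h | ⟨k, hk, hj, hlt⟩
  · exact h
  rcases h' with h' | ⟨k', hk', hj', hlt'⟩
  · exact fun k hk => (h' k hk).symm
  rcases lt_trichotomy k k' with hkk | rfl | hkk
  · exact absurd (hj' k hk hkk) hlt.ne'
  · exact absurd hlt hlt'.asymm
  · exact absurd (hj k' hk' hkk) hlt'.ne'

end Shift

/-! ### Executions of the mechanism -/

section Execution

variable {c : ℝ → ℝ → ℝ} {X Z : Finset ℝ} {Γ D : Finset Pair} {P : Pair}
  {β : Pair → ℕ → ℝ} {Φ : Pair → ℝ → ℝ} {φ : ℝ → ℝ}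

theorem IsPairPotential.congr {b : ℕ → ℝ} {Φ' : Pair → ℝ → ℝ}
    (h : IsPairPotential c X Z Γ P b Φ φ) (hΦ : ∀ Q ∈ subpairs Γ P, Φ Q = Φ' Q) :
    IsPairPotential c X Z Γ P b Φ' φ where
  leaf := h.leaf
  shift i hi s hs := by
    have hp : numSub Γ P ∈ Finset.Icc 1 (numSub Γ P) := by
      rw [Finset.mem_Icc] at hi ⊢
      omega
    rw [← hΦ _ (node_mem hi), ← hΦ _ (node_mem hp)]
    exact h.shift i hi s hs
  job_max := h.job_max
  job_min := h.job_min
  worker := h.worker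

namespace Execution

theorem subset (h : Execution c X Z Γ D β Φ) : D ⊆ Γ := by
  induction h with
  | start => exact Finset.empty_subset _
  | step D β Φ P b φ hex hready hshift hφ ih => exact Finset.insert_subset hready.1 ih

/-- The data stored at a processed pair stay valid: a step alters only the entry of an unprocessed
pair, while the subpairs of a processed pair are already processed. -/
theorem spec (h : Execution c X Z Γ D β Φ) : ∀ P ∈ D, subpairs Γ P ⊆ D ∧
    IsShift c Γ P (β P) ∧ IsPairPotential c X Z Γ P (β P) Φ (Φ P) := by
  induction h with
  | start => simp
  | step D β Φ P b φ hex hready hshift hφ ih =>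
    have hupd : ∀ R, subpairs Γ R ⊆ D → ∀ Q ∈ subpairs Γ R, Φ Q = Function.update Φ P φ Q :=
      fun R hR Q hQ =>
        (Function.update_of_ne (fun h => hready.2.1 (by subst h; exact hR hQ)) _ _).symm
    intro R hR
    rcases Finset.mem_insert.1 hR with rfl | hRD
    · rw [Function.update_self, Function.update_self]
      exact ⟨hready.2.2.trans (Finset.subset_insert _ _), hshift,
        hφ.congr (hupd R hready.2.2)⟩
    · obtain ⟨h1, h2, h3⟩ := ih R hRD
      have hne : R ≠ P := fun h => hready.2.1 (h ▸ hRD)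
      rw [Function.update_of_ne hne, Function.update_of_ne hne]
      exact ⟨h1.trans (Finset.subset_insert _ _), h2, h3.congr (hupd R h1)⟩

theorem isLocalDual (h : Execution c X Z Γ D β Φ) (hL : IsLayered c X Z Γ) :
    ∀ P ∈ D, IsLocalDual c X Z Γ (skillGroup X Z P) (Φ P) := by
  intro P
  induction hn : (pairsWithin Γ P).card using Nat.strong_induction_on generalizing P with
  | _ n ih =>
    intro hP
    obtain ⟨h1, h2, h3⟩ := h.spec P hP
    have hPΓ := h.subset hP
    refine h3.isLocalDual hL hPΓ (fun Q hQ => ?_) h2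
    exact ih _ (hn ▸ hL.card_pairsWithin_lt hPΓ (mem_pairsWithin_of_mem_subpairs hQ)
      (ne_of_mem_subpairs hQ)) Q rfl (h1 hQ)

theorem exists_isReady (h : Execution c X Z Γ D β Φ) (hL : IsLayered c X Z Γ) (hD : D ≠ Γ) :
    ∃ P, IsReady Γ D P := by
  have hne : (Γ \ D).Nonempty := Finset.sdiff_nonempty.2 fun h' => hD (h.subset.antisymm h')
  -- An unprocessed pair with fewest pairs inside its interval has no unprocessed subpair.
  obtain ⟨P, hP, hmin⟩ := (Γ \ D).exists_min_image (fun P => (pairsWithin Γ P).card) hne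
  rw [Finset.mem_sdiff] at hP
  refine ⟨P, hP.1, hP.2, fun Q hQ => ?_⟩
  by_contra hQD
  exact absurd (hmin Q (Finset.mem_sdiff.2 ⟨mem_of_mem_subpairs hQ, hQD⟩)) (not_le.2
    (hL.card_pairsWithin_lt hP.1 (mem_pairsWithin_of_mem_subpairs hQ) (ne_of_mem_subpairs hQ)))

theorem exists_isPairPotential (h : Execution c X Z Γ D β Φ) (hL : IsLayered c X Z Γ)
    (hP : IsReady Γ D P) {b : ℕ → ℝ} (hb : IsShift c Γ P b) :
    ∃ φ, IsPairPotential c X Z Γ P b Φ φ :=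
  hL.exists_isPairPotential hP.1 (fun Q hQ => h.isLocalDual hL Q (hP.2.2 hQ)) hb

/-- Every execution can be completed with the default shifts. -/
theorem exists_complete (h : Execution c X Z Γ D β Φ) (hL : IsLayered c X Z Γ)
    (hβ : ∀ P ∈ D, IsDefaultShift c Γ P (β P)) :
    ∃ β' Φ', Execution c X Z Γ Γ β' Φ' ∧ ∀ P ∈ Γ, IsDefaultShift c Γ P (β' P) := by
  induction hn : (Γ \ D).card using Nat.strong_induction_on generalizing D β Φ with
  | _ n ih =>
    by_cases hD : D = Γ
    · subst hD
      exact ⟨β, Φ, h, hβ⟩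
    obtain ⟨P, hP⟩ := h.exists_isReady hL hD
    obtain ⟨b, hb⟩ := hL.exists_isDefaultShift hP.1
    obtain ⟨φ, hφ⟩ := h.exists_isPairPotential hL hP hb.1
    refine ih _ ?_ (h.step _ _ _ P b φ hP hb.1 hφ) (fun Q hQ => ?_) rfl
    · rw [← hn]
      refine Finset.card_lt_card (Finset.ssubset_iff_of_subset
        (Finset.sdiff_subset_sdiff subset_rfl (Finset.subset_insert _ _)) |>.2 ⟨P, ?_, ?_⟩)
      · exact Finset.mem_sdiff.2 ⟨hP.1, hP.2.1⟩
      · simp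
    · rcases eq_or_ne Q P with rfl | hne
      · rwa [Function.update_self]
      · rw [Function.update_of_ne hne]
        exact hβ Q (Finset.mem_of_mem_insert_of_ne hQ hne)

/-- Relative wages within a group are not affected by later steps of the mechanism. -/
theorem sub_eq_sub_of_subset (h : Execution c X Z Γ Γ β Φ) (hL : IsLayered c X Z Γ) {R : Pair}
    (hR : R ∈ Γ) (hP : P ∈ pairsWithin Γ R) {s s' : ℝ} (hs : s ∈ skillGroup X Z P)
    (hs' : s' ∈ skillGroup X Z P) : Φ R s - Φ R s' = Φ P s - Φ P s' := by
  induction hn : (pairsWithin Γ R).card using Nat.strong_induction_on generalizing R with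
  | _ n ih =>
    by_cases hPR : P = R
    · rw [hPR]
    obtain ⟨Q, hQ, hPQ⟩ := hL.exists_mem_subpairs hP hPR
    have hQΓ := mem_of_mem_subpairs hQ
    rw [← ih _ (hn ▸ hL.card_pairsWithin_lt hR (mem_pairsWithin_of_mem_subpairs hQ)
      (ne_of_mem_subpairs hQ)) hQΓ (mem_pairsWithin.2 ⟨pairsWithin_subset hP, hPQ⟩) rfl]
    obtain ⟨i, hi, rfl⟩ := exists_node_eq hQ
    have h3 := (h.spec R hR).2.2.shift i hi
    rw [h3 s ⟨hs.1, hPQ hs.2⟩, h3 s' ⟨hs'.1, hPQ hs'.2⟩]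
    ring

end Execution

/-! ### Assembling the output from the outermost pairs -/

theorem IsOuterShift.isFamilyShift {γ : ℕ → ℝ} (hγ : IsOuterShift c Γ γ) :
    IsFamilyShift c (outer Γ) (numOuter Γ) γ := hγ

theorem outer_mem {i : ℕ} (hi : i ∈ Finset.Icc 1 (numOuter Γ)) : outer Γ i ∈ Γ :=
  (mem_maximalPairs.1 (pairAt_mem hi)).1

theorem IsLayered.exists_mem_outer (hL : IsLayered c X Z Γ) {s : ℝ} (hs : s ∈ X ∨ s ∈ Z) :
    ∃ i ∈ Finset.Icc 1 (numOuter Γ), s ∈ skillGroup X Z (outer Γ i) := by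
  obtain ⟨Q, hQ, hsQ⟩ := hL.exists_mem_outermost hs
  obtain ⟨i, hi, rfl⟩ := exists_pairAt_eq hQ
  exact ⟨i, hi, hsQ⟩

theorem IsLayered.exists_interval_subset_outer (hL : IsLayered c X Z Γ) (hP : P ∈ Γ) :
    ∃ i ∈ Finset.Icc 1 (numOuter Γ), interval P ⊆ interval (outer Γ i) := by
  obtain ⟨Q, hQ, hPQ⟩ := hL.exists_mem_maximalPairs subset_rfl hP
  obtain ⟨i, hi, rfl⟩ := exists_pairAt_eq hQ
  exact ⟨i, hi, hPQ⟩

theorem Execution.exists_isGlobalPotential (h : Execution c X Z Γ Γ β Φ) (hL : IsLayered c X Z Γ)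
    {γ : ℕ → ℝ} (hγ : IsOuterShift c Γ γ) : ∃ φ, IsGlobalPotential X Z Γ γ Φ φ :=
  hγ.isFamilyShift.exists_glued hL hL.isSeparatedFamily_outer fun _ hi =>
    h.isLocalDual hL _ (outer_mem hi)

theorem IsGlobalPotential.eq {γ : ℕ → ℝ} {φ' : ℝ → ℝ} (hφ : IsGlobalPotential X Z Γ γ Φ φ)
    (hφ' : IsGlobalPotential X Z Γ γ Φ φ') (hL : IsLayered c X Z Γ) {s : ℝ}
    (hs : s ∈ X ∨ s ∈ Z) : φ s = φ' s := by
  obtain ⟨i, hi, hsi⟩ := hL.exists_mem_outer hs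
  rw [hφ i hi s hsi, hφ' i hi s hsi]

theorem IsOutput.sub_eq_sub (h : IsOutput c X Z Γ β Φ φ) (hL : IsLayered c X Z Γ) (hP : P ∈ Γ)
    {s s' : ℝ} (hs : s ∈ skillGroup X Z P) (hs' : s' ∈ skillGroup X Z P) :
    φ s - φ s' = Φ P s - Φ P s' := by
  obtain ⟨hex, γ, -, hφ⟩ := h
  obtain ⟨i, hi, hPi⟩ := hL.exists_interval_subset_outer hP
  rw [hφ i hi s ⟨hs.1, hPi hs.2⟩, hφ i hi s' ⟨hs'.1, hPi hs'.2⟩,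
    ← hex.sub_eq_sub_of_subset hL (outer_mem hi) (mem_pairsWithin.2 ⟨hP, hPi⟩) hs hs']
  ring

theorem IsOutput.sub_le (h : IsOutput c X Z Γ β Φ φ) (hL : IsLayered c X Z Γ) {x z : ℝ}
    (hx : x ∈ X) (hz : z ∈ Z) : φ x - φ z ≤ c x z := by
  obtain ⟨hex, γ, hγ, hφ⟩ := h
  obtain ⟨i, hi, hxi⟩ := hL.exists_mem_outer (Or.inl hx)
  obtain ⟨j, hj, hzj⟩ := hL.exists_mem_outer (Or.inr hz)
  rw [hφ i hi x hxi, hφ j hj z hzj]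
  exact hγ.isFamilyShift.sub_le_of_mem hL hL.isSeparatedFamily_outer
    (fun _ hi => hex.isLocalDual hL _ (outer_mem hi)) hi hj hx hxi.2 hz hzj.2

theorem IsOutput.tight (h : IsOutput c X Z Γ β Φ φ) (hL : IsLayered c X Z Γ) (hP : P ∈ Γ) :
    φ P.1 - φ P.2 = c P.1 P.2 := by
  rw [h.sub_eq_sub hL hP (hL.fst_mem_skillGroup hP) (hL.snd_mem_skillGroup hP)]
  exact hL.sub_eq hP subset_rfl (h.1.isLocalDual hL P hP)

/-! ### Locality -/

/-- No comparison of `X, Z` with `X', Z'` is needed, because a skill group is recovered from its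
pairs. -/
theorem IsLayered.skillGroup_eq_of_pairsWithin_eq {c' : ℝ → ℝ → ℝ} {X' Z' : Finset ℝ}
    {Γ' : Finset Pair} (hL : IsLayered c X Z Γ) (hL' : IsLayered c' X' Z' Γ') (hP : P ∈ Γ)
    (h : pairsWithin Γ P = pairsWithin Γ' P) : skillGroup X Z P = skillGroup X' Z' P := by
  have hP' : P ∈ Γ' := pairsWithin_subset (h ▸ self_mem_pairsWithin hP)
  rw [hL.skillGroup_eq hP, hL'.skillGroup_eq hP', h]

theorem pairsWithin_eq_of_mem {Γ' : Finset Pair} {Q : Pair}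
    (h : pairsWithin Γ P = pairsWithin Γ' P) (hQ : Q ∈ pairsWithin Γ P) :
    pairsWithin Γ Q = pairsWithin Γ' Q := by
  have hQP := (mem_pairsWithin.1 hQ).2
  rw [← pairsWithin_pairsWithin hQP, h, pairsWithin_pairsWithin hQP]

theorem subpairs_eq_of_pairsWithin_eq {Γ' : Finset Pair}
    (h : pairsWithin Γ P = pairsWithin Γ' P) : subpairs Γ P = subpairs Γ' P := by
  rw [subpairs, subpairs, h]

theorem node_eq_of_pairsWithin_eq {Γ' : Finset Pair}
    (h : pairsWithin Γ P = pairsWithin Γ' P) : node Γ P = node Γ' P := by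
  funext i
  rw [node, node, subpairs_eq_of_pairsWithin_eq h]

theorem numSub_eq_of_pairsWithin_eq {Γ' : Finset Pair}
    (h : pairsWithin Γ P = pairsWithin Γ' P) : numSub Γ P = numSub Γ' P := by
  rw [numSub, numSub, subpairs_eq_of_pairsWithin_eq h]

theorem IsShift.of_pairsWithin_eq {Γ' : Finset Pair} {b : ℕ → ℝ}
    (hb : IsShift c Γ P b) (h : pairsWithin Γ P = pairsWithin Γ' P) : IsShift c Γ' P b := by
  unfold IsShift at hb ⊢
  rwa [← node_eq_of_pairsWithin_eq h, ← numSub_eq_of_pairsWithin_eq h]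

theorem IsDefaultShift.eq_of_pairsWithin_eq {Γ' : Finset Pair} {b b' : ℕ → ℝ}
    (hb : IsDefaultShift c Γ P b) (hb' : IsDefaultShift c Γ' P b')
    (h : pairsWithin Γ P = pairsWithin Γ' P) : ∀ k ∈ Finset.Icc 2 (numSub Γ P), b k = b' k := by
  have h1 := hb'.2 b (hb.1.of_pairsWithin_eq h)
  rw [← numSub_eq_of_pairsWithin_eq h] at h1
  exact (hb.2 b' (hb'.1.of_pairsWithin_eq h.symm)).eq_of_symm h1

theorem IsPairPotential.of_pairsWithin_eq {X' Z' : Finset ℝ} {Γ' : Finset Pair} {b : ℕ → ℝ}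
    (hL : IsLayered c X Z Γ) (hL' : IsLayered c X' Z' Γ')
    (hφ : IsPairPotential c X Z Γ P b Φ φ) (h : pairsWithin Γ P = pairsWithin Γ' P) :
    IsPairPotential c X' Z' Γ' P b Φ φ := by
  have hn := node_eq_of_pairsWithin_eq h
  have hp := numSub_eq_of_pairsWithin_eq h
  obtain ⟨h1, h2, h3, h4, h5⟩ := hφ
  simp only [hn, hp] at h1 h2 h3 h4 h5
  refine ⟨h1, fun i hi s hs => h2 i hi s ?_, h3, h4, h5⟩
  have hi' : i ∈ Finset.Icc 1 (numSub Γ P) := hp ▸ hi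
  have hmem := node_mem hi'
  rw [hn] at hmem
  rwa [hL.skillGroup_eq_of_pairsWithin_eq hL' (mem_of_mem_subpairs hmem)
    (pairsWithin_eq_of_mem h (mem_pairsWithin_of_mem_subpairs hmem))]

/-- The potential of a pair depends only on the pairs and shifts within its interval. -/
theorem Execution.eqOn_of_pairsWithin_eq {X' Z' : Finset ℝ} {Γ' : Finset Pair}
    {β' : Pair → ℕ → ℝ} {Φ' : Pair → ℝ → ℝ} (hL : IsLayered c X Z Γ)
    (hL' : IsLayered c X' Z' Γ') (hex : Execution c X Z Γ Γ β Φ)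
    (hex' : Execution c X' Z' Γ' Γ' β' Φ') (hP : P ∈ Γ)
    (h : pairsWithin Γ P = pairsWithin Γ' P)
    (hβ : ∀ Q ∈ pairsWithin Γ P, ∀ k ∈ Finset.Icc 2 (numSub Γ Q), β Q k = β' Q k) :
    Set.EqOn (Φ P) (Φ' P) (skillGroup X Z P) := by
  induction hn : (pairsWithin Γ P).card using Nat.strong_induction_on generalizing P with
  | _ n ih =>
    have hP' : P ∈ Γ' := pairsWithin_subset (h ▸ self_mem_pairsWithin hP)
    have h1 := (hex.spec P hP).2.2
    -- The computation in the second problem is read as one in the first, so that uniqueness of the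
    -- pair potential applies.
    have h2 := ((hex'.spec P hP').2.2).of_pairsWithin_eq hL' hL h.symm
    refine h1.eqOn h2 hL hP (hβ P (self_mem_pairsWithin hP)) fun Q hQ => ?_
    have hQP := mem_pairsWithin_of_mem_subpairs hQ
    refine ih _ (hn ▸ hL.card_pairsWithin_lt hP hQP (ne_of_mem_subpairs hQ))
      (mem_of_mem_subpairs hQ) (pairsWithin_eq_of_mem h hQP) (fun R hR => hβ R ?_) rfl
    rw [mem_pairsWithin] at hR ⊢
    exact ⟨hR.1, hR.2.trans (mem_pairsWithin.1 hQP).2⟩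

end Execution

/-! ### The main theorem -/

theorem theorem1 (h : ℝ → ℝ) (hh : IsMismatchProfile h) (c : ℝ → ℝ → ℝ)
    (hc : ∀ x z, c x z = h (z - x))
    (F G : Measure ℝ) (X Z : Finset ℝ) (π : Measure Pair) (Γ : Finset Pair)
    (hπ : IsOptimallyAssigned c F G X Z π Γ) :
    -- every inequality system is feasible, and has a smallest solution in dictionary order
    (∀ P ∈ Γ, (∃ b, IsShift c Γ P b) ∧ ∃ b, IsDefaultShift c Γ P b) ∧
    (∃ γ, IsOuterShift c Γ γ) ∧
    -- the mechanism never gets stuck: while there are unprocessed pairs, some pair can be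
    -- processed, and at each such pair every choice of the shifts determines a potential
    (∀ D β Φ, Execution c X Z Γ D β Φ →
      (D ≠ Γ → ∃ P, IsReady Γ D P) ∧
      ∀ P, IsReady Γ D P → ∀ b, IsShift c Γ P b →
        ∃ φ, IsPairPotential c X Z Γ P b Φ φ ∧
          ∀ φ', IsPairPotential c X Z Γ P b Φ φ' → Set.EqOn φ' φ (skillGroup X Z P)) ∧
    -- all the potentials computed on the way are local dual optimizers
    (∀ D β Φ, Execution c X Z Γ D β Φ →
      ∀ P ∈ D, IsLocalDual c X Z Γ (skillGroup X Z P) (Φ P)) ∧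
    -- once all pairs are processed, every solution of the outer system determines a potential
    (∀ β Φ, Execution c X Z Γ Γ β Φ → ∀ γ, IsOuterShift c Γ γ →
      ∃ φ, IsGlobalPotential X Z Γ γ Φ φ ∧
        ∀ φ', IsGlobalPotential X Z Γ γ Φ φ' → ∀ s, s ∈ X ∨ s ∈ Z → φ' s = φ s) ∧
    -- the mechanism has an output, also with the default shifts
    (∃ β Φ φ, IsOutput c X Z Γ β Φ φ ∧ ∀ P ∈ Γ, IsDefaultShift c Γ P (β P)) ∧
    -- every output is an optimal dual pair, tight at the pairs of the optimal assignment, and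
    -- relative wages within a group are those of the local potential of the group
    (∀ β Φ φ, IsOutput c X Z Γ β Φ φ →
      IsOptimalDualPair c F G X Z φ (-φ) ∧
      (∀ P ∈ Γ, φ P.1 - φ P.2 = c P.1 P.2) ∧
      ∀ P ∈ Γ, ∀ s ∈ skillGroup X Z P, ∀ s' ∈ skillGroup X Z P,
        φ s - φ s' = Φ P s - Φ P s') ∧
    -- locality: in two problems that have the same pairings within a group, with the same shifts
    -- at these pairings (in particular, with the default shifts), the relative wages within the
    -- group are the same
    (∀ (F' G' : Measure ℝ) (X' Z' : Finset ℝ) (π' : Measure Pair) (Γ' : Finset Pair),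
      IsOptimallyAssigned c F' G' X' Z' π' Γ' →
      ∀ β Φ φ β' Φ' φ', IsOutput c X Z Γ β Φ φ → IsOutput c X' Z' Γ' β' Φ' φ' →
      ∀ P ∈ Γ, pairsWithin Γ P = pairsWithin Γ' P →
        ((∀ Q ∈ pairsWithin Γ P, ∀ k ∈ Finset.Icc 2 (numSub Γ Q), β Q k = β' Q k) ∨
          ∀ Q ∈ pairsWithin Γ P,
            IsDefaultShift c Γ Q (β Q) ∧ IsDefaultShift c Γ' Q (β' Q)) →
        skillGroup X Z P = skillGroup X' Z' P ∧
        ∀ s ∈ skillGroup X Z P, ∀ s' ∈ skillGroup X Z P, φ s - φ s' = φ' s - φ' s') := by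
  have hL := hπ.isLayered hh hc
  refine ⟨fun P hP => ⟨hL.exists_isShift hP, hL.exists_isDefaultShift hP⟩,
    hL.exists_isOuterShift, fun D β Φ hex => ⟨hex.exists_isReady hL, fun P hP b hb => ?_⟩,
    fun D β Φ hex => hex.isLocalDual hL, fun β Φ hex γ hγ => ?_, ?_, fun β Φ φ hout => ?_, ?_⟩
  · obtain ⟨φ, hφ⟩ := hex.exists_isPairPotential hL hP hb
    exact ⟨φ, hφ, fun φ' hφ' =>
      hφ'.eqOn hφ hL hP.1 (fun _ _ => rfl) fun Q _ => Set.eqOn_refl (Φ Q) _⟩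
  · obtain ⟨φ, hφ⟩ := hex.exists_isGlobalPotential hL hγ
    exact ⟨φ, hφ, fun φ' hφ' s hs => hφ'.eq hφ hL hs⟩
  · obtain ⟨β, Φ, hex, hβ⟩ := Execution.start.exists_complete hL (by simp)
    obtain ⟨γ, hγ⟩ := hL.exists_isOuterShift
    obtain ⟨φ, hφ⟩ := hex.exists_isGlobalPotential hL hγ
    exact ⟨β, Φ, φ, ⟨hex, γ, hγ, hφ⟩, hβ⟩
  · exact ⟨hπ.isOptimalDualPair (fun x hx z hz => hout.sub_le hL hx hz)
      fun P hP => hout.tight hL hP, fun P hP => hout.tight hL hP,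
      fun P hP s hs s' hs' => hout.sub_eq_sub hL hP hs hs'⟩
  · intro F' G' X' Z' π' Γ' hπ' β Φ φ β' Φ' φ' hout hout' P hP hwithin hshifts
    have hL' := hπ'.isLayered hh hc
    have hP' : P ∈ Γ' := pairsWithin_subset (hwithin ▸ self_mem_pairsWithin hP)
    have hgroup := hL.skillGroup_eq_of_pairsWithin_eq hL' hP hwithin
    -- Default shifts are least solutions of the same system in both problems, hence agree by
    -- antisymmetry; this reduces the second alternative to the first.
    have hβ : ∀ Q ∈ pairsWithin Γ P, ∀ k ∈ Finset.Icc 2 (numSub Γ Q), β Q k = β' Q k :=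
      hshifts.elim id fun hd Q hQ => (hd Q hQ).1.eq_of_pairsWithin_eq (hd Q hQ).2
        (pairsWithin_eq_of_mem hwithin hQ)
    have heq := hout.1.eqOn_of_pairsWithin_eq hL hL' hout'.1 hP hwithin hβ
    refine ⟨hgroup, fun s hs s' hs' => ?_⟩
    rw [hout.sub_eq_sub hL hP hs hs', hout'.sub_eq_sub hL' hP' (hgroup ▸ hs) (hgroup ▸ hs'),
      heq hs, heq hs']
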